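/- Let $V$ be a finite set. A weighted graph $G$ on $V$ is a function $w_G\colon V^2\to\mathbb R_{\ge 0}$; it has uniform weight $w>0$ if for all $i,j\in V$ one has $w_G(i,j)\in\{0,w\}$, $w_G(i,j)=w_G(j,i)$ and $w_G(i,i)=0$. For a word $x=x_1\cdots x_n\in V^n$ and a permutation $\sigma\in S_n$ (the symbol $x_{\sigma(t)}$ arrives at time $t$) let $L_t=\{\sigma(s): s<t,\ \sigma(s)<\sigma(t)\}$ and $R_t=\{\sigma(s): s<t,\ \sigma(s)>\sigma(t)\}$, and put \[ w(x;\sigma)=\prod_{t:\,L_t\ne\emptyset} w_G\bigl(x_{\max L_t},x_{\sigma(t)}\bigr)\prod_{t:\,R_t\ne\emptyset} w_G\bigl(x_{\sigma(t)},x_{\min R_t}\bigr),\qquad B(x)=\sum_{\sigma\in S_n}w(x;\sigma),\qquad \mathbb P_n(x)=\frac{B(x)}{\sum_{y\in V^n}B(y)} . \] The insertion algorithm on $G$ is the family $(\mathbb P_n)_{n\ge 0}$. It is consistent if $\mathbb P_n(x)=\sum_{v\in V}\mathbb P_{n+1}(xv)=\sum_{v\in V}\mathbb P_{n+1}(vx)$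 for all $n$ and all $x\in V^n$ (in particular, all $\mathbb P_n$ are well-defined probability measures); the associated insertion process is then the stationary process $(X_i)_{i\in\mathbb Z}$ in $V$ with $\mathbb P\bigl((X_{i+1},\dots,X_{i+n})=x\bigr)=\mathbb P_n(x)$ for all $i\in\mathbb Z$, $n\ge 0$, $x\in V^n$. For an integer $k\ge 0$, a stationary process is $k$-dependent if $(X_i)_{i<0}$ and $(X_i)_{i\ge k}$ are independent. **Theorem.** Let $G$ be a weighted graph on a finite set with uniform weight $w>0$, and let $k\ge 0$ be an integer. Then the insertion algorithm on $G$ is consistent and its insertion process is $k$-dependent if and only if $w=1$ and either - $G$ is isomorphic to the complete tripartite graph $K_{r,r,r}$ for some $r\ge 1$, and $k\ge 2$; or - $G$ is isomorphic to the complete $4$-partite graph $K_{r,r,r,r}$ for some $r\ge 1$, and $k\ge 1$. (Here an unweighted graph is identified with the weighted graph that gives each edge weight $1$ and each non-edge weight $0$.) -/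

import Mathlib

open MeasureTheory ProbabilityTheory

/-- A weighted graph on `V`: a function `V² → ℝ_{≥ 0}`. -/
structure WeightedGraph (V : Type*) where
  weight : V → V → ℝ
  weight_nonneg : ∀ i j, 0 ≤ weight i j

namespace WeightedGraph

/-- The times before `t` at which indices to the left of `σ t` arrive. -/
def leftTimes {n : ℕ} (σ : Equiv.Perm (Fin n)) (t : Fin n) : Finset (Fin n) :=
  Finset.univ.filter fun s => s < t ∧ σ s < σ t

/-- The times before `t` at which indices to the right of `σ t` arrive. -/
def rightTimes {n : ℕ} (σ : Equiv.Perm (Fin n)) (t : Fin n) : Finset (Fin n) :=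
  Finset.univ.filter fun s => s < t ∧ σ t < σ s

/-- The weight of the edge joining the symbol that arrives at time `t` to its left neighbour among
the symbols already present, i.e. the one with the largest index below `σ t`;
`1` if there is no such symbol. -/
noncomputable def leftFactor {V : Type*} (G : WeightedGraph V) {n : ℕ} (x : Fin n → V)
    (σ : Equiv.Perm (Fin n)) (t : Fin n) : ℝ :=
  if h : (leftTimes σ t).Nonempty then
    G.weight (x (((leftTimes σ t).image σ).max' (h.image σ))) (x (σ t))
  else 1

/-- The weight of the edge joining the symbol that arrives at time `t` to its right neighbour among
the symbols already present, i.e. the one with the smallest index above `σ t`;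
`1` if there is no such symbol. -/
noncomputable def rightFactor {V : Type*} (G : WeightedGraph V) {n : ℕ} (x : Fin n → V)
    (σ : Equiv.Perm (Fin n)) (t : Fin n) : ℝ :=
  if h : (rightTimes σ t).Nonempty then
    G.weight (x (σ t)) (x (((rightTimes σ t).image σ).min' (h.image σ)))
  else 1

/-- The building weight `w(x; σ)`: the product of the edge weights in the constraint graph of
the building `(x, σ)`, in which the symbol `x (σ t)` arrives at time `t`. -/
noncomputable def buildingWeight {V : Type*} (G : WeightedGraph V) {n : ℕ} (x : Fin n → V)
    (σ : Equiv.Perm (Fin n)) : ℝ :=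
  (∏ t, G.leftFactor x σ t) * ∏ t, G.rightFactor x σ t

/-- The weighted building count `B(x)`. -/
noncomputable def buildingCount {V : Type*} (G : WeightedGraph V) {n : ℕ} (x : Fin n → V) : ℝ :=
  ∑ σ : Equiv.Perm (Fin n), G.buildingWeight x σ

/-- `ℙ_n(x) = B(x) / ∑_y B(y)`, the distribution on `V^n` given by the insertion algorithm. -/
noncomputable def insertionProb {V : Type*} [Fintype V] (G : WeightedGraph V) {n : ℕ}
    (x : Fin n → V) : ℝ :=
  G.buildingCount x / ∑ y : Fin n → V, G.buildingCount y

/-- Consistency of the family `(ℙ_n)`. The case `n = 0` forces `V` to be nonempty, and by induction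
every normalizing sum `∑_y B(y)` is then nonzero, so no division by zero is hidden here. -/
def IsConsistent {V : Type*} [Fintype V] (G : WeightedGraph V) : Prop :=
  ∀ (n : ℕ) (x : Fin n → V),
    G.insertionProb x = ∑ v : V, G.insertionProb (Fin.snoc x v : Fin (n + 1) → V) ∧
    G.insertionProb x = ∑ v : V, G.insertionProb (Fin.cons v x : Fin (n + 1) → V)

/-- `μ` is the law on `V^ℤ` of the insertion process of `G`: a probability measure under which the
word read in every window `{i + 1, …, i + n}` has distribution `ℙ_n`. -/
structure IsInsertionLaw {V : Type*} [Fintype V] [MeasurableSpace V] (G : WeightedGraph V)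
    (μ : Measure (ℤ → V)) : Prop where
  isProbabilityMeasure : IsProbabilityMeasure μ
  marginal : ∀ (i : ℤ) (n : ℕ) (x : Fin n → V),
    μ {ξ | ∀ j : Fin n, ξ (i + 1 + (j : ℤ)) = x j} = ENNReal.ofReal (G.insertionProb x)

/-- `G` has uniform weight `w`. -/
structure HasUniformWeight {V : Type*} (G : WeightedGraph V) (w : ℝ) : Prop where
  pos : 0 < w
  eq_zero_or_eq : ∀ i j, G.weight i j = 0 ∨ G.weight i j = w
  symm : ∀ i j, G.weight i j = G.weight j i
  loopless : ∀ i, G.weight i i = 0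

/-- The (unweighted) complete multipartite graph with `q` parts of size `r`, as a weighted graph
with weights `0` and `1`: vertices are adjacent iff they are incongruent modulo `q`. -/
def completeMultipartite (q r : ℕ) : WeightedGraph (Fin (q * r)) where
  weight i j := if (i : ℕ) % q ≠ (j : ℕ) % q then 1 else 0
  weight_nonneg i j := by split_ifs <;> norm_num

/-- Two weighted graphs are the same up to relabelling of the vertices. -/
def IsIsomorphic {V V' : Type*} (G : WeightedGraph V) (H : WeightedGraph V') : Prop :=
  ∃ e : V ≃ V', ∀ i j, G.weight i j = H.weight (e i) (e j)

end WeightedGraph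

/-- The law `μ` of a process `(X_i)_{i ∈ ℤ}` is stationary and `k`-dependent: it is shift
invariant, and `(X_i)_{i < 0}` and `(X_i)_{i ≥ k}` are independent. -/
structure IsStationaryKDependent {V : Type*} [MeasurableSpace V] (k : ℕ)
    (μ : Measure (ℤ → V)) : Prop where
  stationary : μ.map (fun (ξ : ℤ → V) (i : ℤ) => ξ (i + 1)) = μ
  indep : IndepFun (fun (ξ : ℤ → V) (i : Set.Iio (0 : ℤ)) => ξ i)
    (fun (ξ : ℤ → V) (i : Set.Ici (k : ℤ)) => ξ i) μ

/-! Sort the buildings of a word by the symbol that arrives last. If consecutive letters are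
adjacent, `B(x)` is a weighted sum of the counts of the words with one letter deleted, with weight
`w` at the two ends and `w ^ 2` inside; every other word has count zero. For `w = 1` this is the
plain deletion sum (`wordCount_eq_delSum`).

Sufficiency. Let `N = |V|` and let all parts have size `s`. Study `gapSum k x y`, the sum of
`B(xzy)` over the gaps `z` of length `k`. A deletion inside a gap of length `k + 1` can be undone at
`k + 1` places, each time by any of the `N - 2s` common neighbours of the two letters around it.
Deleting the last letter of `x` gives all gaps except those starting with one of its `s`
non-neighbours (itself included); these are twins of the deleted letter, so they account for `s`
copies of the gap sum of length `k`. The same happens on the right. Hence `gapSum_rec`: the gap sum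
is the sum of the deletions in `x`, the deletions in `y`, and `(k + 1)(N - 2s) - 2s` times the
shorter gap sum. When that coefficient vanishes, the gap sum obeys the recursion of `B(x) B(y)` and
is a multiple of it depending on the lengths only, so the two words decouple. For `N = qs` this
means `(k + 1)(q - 2) = 2`: four parts with gap 1, or three parts with gap 2.

Necessity. Consistency for words of lengths 1, 2, 3 gives a constant degree `d`, a constant number
`t` of triangles on each edge, and control of common neighbours inside a neighbourhood. Independence
of single symbols across the gap makes `gapSum k [a] [c]` a nonzero constant. If `t = 0`, gap sums
are multiples of entries of a power of the adjacency matrix, and no such power is constant. If `t >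
0`, averaging the length-3 identity forces `w = 1`, and non-adjacent vertices turn out to be twins,
so the graph is complete multipartite with equal parts. The recursion then makes `gapSum k [a] [a] -
gapSum k [a] [c]`, for adjacent `a`, `c`, a nonzero number times the product of the factors `j(N -
2s) - 2s` with `1 ≤ j ≤ k`; one of them must vanish. -/

namespace WeightedGraph

/-! ### Buildings and their last arrival -/

section Recursion

variable {V : Type*} (G : WeightedGraph V) {n : ℕ}

lemma leftFactor_eq_weight (x : Fin n → V) {σ : Equiv.Perm (Fin n)} {s t : Fin n}
    (hst : s < t) (hσ : σ s < σ t) (hmax : ∀ s' < t, σ s' < σ t → σ s' ≤ σ s) :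
    G.leftFactor x σ t = G.weight (x (σ s)) (x (σ t)) := by
  have hs : s ∈ leftTimes σ t := by simp [leftTimes, hst, hσ]
  rw [leftFactor, dif_pos ⟨s, hs⟩]
  congr 2
  refine le_antisymm (Finset.max'_le _ _ _ ?_) (Finset.le_max' _ _ (Finset.mem_image_of_mem _ hs))
  intro j hj
  obtain ⟨s', hs', rfl⟩ := Finset.mem_image.1 hj
  simp only [leftTimes, Finset.mem_filter, Finset.mem_univ, true_and] at hs'
  exact hmax s' hs'.1 hs'.2

lemma leftFactor_eq_one (x : Fin n → V) {σ : Equiv.Perm (Fin n)} {t : Fin n}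
    (h : ∀ s < t, ¬ σ s < σ t) : G.leftFactor x σ t = 1 := by
  rw [leftFactor, dif_neg]
  rintro ⟨s, hs⟩
  simp only [leftTimes, Finset.mem_filter, Finset.mem_univ, true_and] at hs
  exact h s hs.1 hs.2

lemma rightFactor_eq_weight (x : Fin n → V) {σ : Equiv.Perm (Fin n)} {s t : Fin n}
    (hst : s < t) (hσ : σ t < σ s) (hmin : ∀ s' < t, σ t < σ s' → σ s ≤ σ s') :
    G.rightFactor x σ t = G.weight (x (σ t)) (x (σ s)) := by
  have hs : s ∈ rightTimes σ t := by simp [rightTimes, hst, hσ]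
  rw [rightFactor, dif_pos ⟨s, hs⟩]
  congr 2
  refine le_antisymm (Finset.min'_le _ _ (Finset.mem_image_of_mem _ hs)) (Finset.le_min' _ _ _ ?_)
  intro j hj
  obtain ⟨s', hs', rfl⟩ := Finset.mem_image.1 hj
  simp only [rightTimes, Finset.mem_filter, Finset.mem_univ, true_and] at hs'
  exact hmin s' hs'.1 hs'.2

lemma rightFactor_eq_one (x : Fin n → V) {σ : Equiv.Perm (Fin n)} {t : Fin n}
    (h : ∀ s < t, ¬ σ t < σ s) : G.rightFactor x σ t = 1 := by
  rw [rightFactor, dif_neg]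
  rintro ⟨s, hs⟩
  simp only [rightTimes, Finset.mem_filter, Finset.mem_univ, true_and] at hs
  exact h s hs.1 hs.2

/-- A word with two consecutive symbols joined by an edge of weight zero has no building. -/
lemma buildingCount_eq_zero (x : Fin n → V) {j : ℕ} (hj : j + 1 < n)
    (h : G.weight (x ⟨j, by omega⟩) (x ⟨j + 1, hj⟩) = 0) : G.buildingCount x = 0 := by
  refine Finset.sum_eq_zero fun σ _ => ?_
  have hs : σ (σ.symm ⟨j, by omega⟩) = ⟨j, by omega⟩ := by simp
  have ht : σ (σ.symm ⟨j + 1, hj⟩) = ⟨j + 1, hj⟩ := by simp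
  generalize σ.symm ⟨j, by omega⟩ = s at hs
  generalize σ.symm ⟨j + 1, hj⟩ = t at ht
  have hne : s ≠ t := by
    rintro rfl
    rw [hs] at ht
    simp at ht
  rcases lt_or_gt_of_ne hne with hlt | hlt
  · have : G.leftFactor x σ t = 0 := by
      rw [G.leftFactor_eq_weight x hlt, hs, ht, h]
      · rw [hs, ht, Fin.mk_lt_mk]; omega
      · intro s' _ h'
        rw [ht, Fin.lt_def] at h'
        rw [hs, Fin.le_def]
        simp only at h' ⊢
        omega
    rw [buildingWeight, Finset.prod_eq_zero (Finset.mem_univ t) this, zero_mul]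
  · have : G.rightFactor x σ s = 0 := by
      rw [G.rightFactor_eq_weight x hlt, hs, ht, h]
      · rw [hs, ht, Fin.mk_lt_mk]; omega
      · intro s' _ h'
        rw [hs, Fin.lt_def] at h'
        rw [ht, Fin.le_def]
        simp only at h' ⊢
        omega
    rw [buildingWeight, Finset.prod_eq_zero (Finset.mem_univ s) this, mul_zero]

/-- The order of arrival in which the index `i` arrives last and the others arrive according
to `τ`. -/
def insertLast (i : Fin (n + 1)) (τ : Equiv.Perm (Fin n)) : Equiv.Perm (Fin (n + 1)) :=
  finSuccEquivLast.trans ((Equiv.optionCongr τ).trans (finSuccEquiv' i).symm)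

@[simp] lemma insertLast_last (i : Fin (n + 1)) (τ : Equiv.Perm (Fin n)) :
    insertLast i τ (Fin.last n) = i := by
  simp [insertLast]

@[simp] lemma insertLast_castSucc (i : Fin (n + 1)) (τ : Equiv.Perm (Fin n)) (s : Fin n) :
    insertLast i τ s.castSucc = i.succAbove (τ s) := by
  simp [insertLast]

lemma bijective_insertLast :
    Function.Bijective fun p : Fin (n + 1) × Equiv.Perm (Fin n) => insertLast p.1 p.2 := by
  rw [Fintype.bijective_iff_injective_and_card]
  refine ⟨?_, by simp [Fintype.card_perm, Nat.factorial_succ]⟩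
  rintro ⟨i, τ⟩ ⟨i', τ'⟩ h
  simp only at h
  have hi : i = i' := by simpa using DFunLike.congr_fun h (Fin.last n)
  subst hi
  refine Prod.ext rfl (Equiv.ext fun s => ?_)
  simpa using DFunLike.congr_fun h s.castSucc

/-- Earlier arrivals do not see the last one, and `succAbove` preserves order, so their left
neighbours are unchanged. -/
lemma leftFactor_insertLast_castSucc (x : Fin (n + 1) → V) (i : Fin (n + 1))
    (τ : Equiv.Perm (Fin n)) (t : Fin n) :
    G.leftFactor x (insertLast i τ) t.castSucc = G.leftFactor (x ∘ i.succAbove) τ t := by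
  by_cases h : ∃ s < t, τ s < τ t
  · obtain ⟨s, hs, hmax⟩ := Finset.exists_max_image (leftTimes τ t) τ
      (by obtain ⟨s, hs⟩ := h; exact ⟨s, by simpa [leftTimes] using hs⟩)
    simp only [leftTimes, Finset.mem_filter, Finset.mem_univ, true_and] at hs hmax
    rw [G.leftFactor_eq_weight _ hs.1 hs.2 fun s' h1 h2 => hmax s' ⟨h1, h2⟩,
      G.leftFactor_eq_weight x (s := s.castSucc)]
    · simp
    · simpa using hs.1
    · simpa using hs.2
    · intro s'
      refine Fin.lastCases (fun h => absurd h (Fin.not_lt.2 (Fin.le_last _)))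
        (fun s' h1 h2 => ?_) s'
      simp only [insertLast_castSucc, Fin.succAbove_lt_succAbove_iff,
        Fin.succAbove_le_succAbove_iff, Fin.castSucc_lt_castSucc_iff] at h1 h2 ⊢
      exact hmax s' ⟨h1, h2⟩
  · push Not at h
    rw [G.leftFactor_eq_one _ fun s hs => not_lt.2 (h s hs), G.leftFactor_eq_one]
    intro s
    refine Fin.lastCases (fun h => absurd h (Fin.not_lt.2 (Fin.le_last _))) (fun s h1 => ?_) s
    simp only [insertLast_castSucc, Fin.succAbove_lt_succAbove_iff,
      Fin.castSucc_lt_castSucc_iff] at h1 ⊢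
    exact not_lt.2 (h s h1)

lemma rightFactor_insertLast_castSucc (x : Fin (n + 1) → V) (i : Fin (n + 1))
    (τ : Equiv.Perm (Fin n)) (t : Fin n) :
    G.rightFactor x (insertLast i τ) t.castSucc = G.rightFactor (x ∘ i.succAbove) τ t := by
  by_cases h : ∃ s < t, τ t < τ s
  · obtain ⟨s, hs, hmin⟩ := Finset.exists_min_image (rightTimes τ t) τ
      (by obtain ⟨s, hs⟩ := h; exact ⟨s, by simpa [rightTimes] using hs⟩)
    simp only [rightTimes, Finset.mem_filter, Finset.mem_univ, true_and] at hs hmin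
    rw [G.rightFactor_eq_weight _ hs.1 hs.2 fun s' h1 h2 => hmin s' ⟨h1, h2⟩,
      G.rightFactor_eq_weight x (s := s.castSucc)]
    · simp
    · simpa using hs.1
    · simpa using hs.2
    · intro s'
      refine Fin.lastCases (fun h => absurd h (Fin.not_lt.2 (Fin.le_last _)))
        (fun s' h1 h2 => ?_) s'
      simp only [insertLast_castSucc, Fin.succAbove_lt_succAbove_iff,
        Fin.succAbove_le_succAbove_iff, Fin.castSucc_lt_castSucc_iff] at h1 h2 ⊢
      exact hmin s' ⟨h1, h2⟩
  · push Not at h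
    rw [G.rightFactor_eq_one _ fun s hs => not_lt.2 (h s hs), G.rightFactor_eq_one]
    intro s
    refine Fin.lastCases (fun h => absurd h (Fin.not_lt.2 (Fin.le_last _))) (fun s h1 => ?_) s
    simp only [insertLast_castSucc, Fin.succAbove_lt_succAbove_iff,
      Fin.castSucc_lt_castSucc_iff] at h1 ⊢
    exact not_lt.2 (h s h1)

lemma leftFactor_insertLast_last_zero (x : Fin (n + 1) → V) (τ : Equiv.Perm (Fin n)) :
    G.leftFactor x (insertLast 0 τ) (Fin.last n) = 1 :=
  G.leftFactor_eq_one x fun s _ => by simp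

lemma rightFactor_insertLast_last_last (x : Fin (n + 1) → V) (τ : Equiv.Perm (Fin n)) :
    G.rightFactor x (insertLast (Fin.last n) τ) (Fin.last n) = 1 :=
  G.rightFactor_eq_one x fun s _ => by simp [Fin.le_last]

lemma leftFactor_insertLast_last_succ (x : Fin (n + 1) → V) (i : Fin n)
    (τ : Equiv.Perm (Fin n)) :
    G.leftFactor x (insertLast i.succ τ) (Fin.last n) = G.weight (x i.castSucc) (x i.succ) := by
  have hs : insertLast i.succ τ (τ.symm i).castSucc = i.castSucc := by
    simp
  rw [G.leftFactor_eq_weight x (s := (τ.symm i).castSucc) (Fin.castSucc_lt_last _), hs,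
    insertLast_last]
  · rw [hs, insertLast_last]; exact Fin.castSucc_lt_succ
  · intro s' _ h
    rw [insertLast_last] at h
    rw [hs]
    exact Fin.le_castSucc_iff.2 h

lemma rightFactor_insertLast_last_castSucc (x : Fin (n + 1) → V) (i : Fin n)
    (τ : Equiv.Perm (Fin n)) :
    G.rightFactor x (insertLast i.castSucc τ) (Fin.last n) =
      G.weight (x i.castSucc) (x i.succ) := by
  have hs : insertLast i.castSucc τ (τ.symm i).castSucc = i.succ := by
    simp
  rw [G.rightFactor_eq_weight x (s := (τ.symm i).castSucc) (Fin.castSucc_lt_last _), hs,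
    insertLast_last]
  · rw [hs, insertLast_last]; exact Fin.castSucc_lt_succ
  · intro s' _ h
    rw [insertLast_last] at h
    rw [hs]
    exact Fin.castSucc_lt_iff_succ_le.1 h

lemma buildingWeight_insertLast (x : Fin (n + 1) → V) (i : Fin (n + 1))
    (τ : Equiv.Perm (Fin n)) :
    G.buildingWeight x (insertLast i τ) =
      G.leftFactor x (insertLast i τ) (Fin.last n) * G.rightFactor x (insertLast i τ) (Fin.last n) *
        G.buildingWeight (x ∘ i.succAbove) τ := by
  simp only [buildingWeight, Fin.prod_univ_castSucc, leftFactor_insertLast_castSucc,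
    rightFactor_insertLast_castSucc]
  ring

lemma buildingCount_eq_sum (x : Fin (n + 1) → V) :
    G.buildingCount x =
      ∑ i : Fin (n + 1), ∑ τ : Equiv.Perm (Fin n), G.buildingWeight x (insertLast i τ) := by
  rw [buildingCount, ← Fintype.sum_prod_type'
    (f := fun i τ => G.buildingWeight x (insertLast i τ))]
  exact (Function.Bijective.sum_comp bijective_insertLast
    (fun σ => G.buildingWeight x σ)).symm

lemma buildingCount_zero (x : Fin 0 → V) : G.buildingCount x = 1 := by
  simp [buildingCount, buildingWeight]

lemma buildingCount_one (x : Fin 1 → V) : G.buildingCount x = 1 := by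
  rw [buildingCount_eq_sum]
  have h1 : ∀ τ, G.leftFactor x (insertLast 0 τ) 0 = 1 := G.leftFactor_insertLast_last_zero x
  have h2 : ∀ τ, G.rightFactor x (insertLast 0 τ) 0 = 1 := G.rightFactor_insertLast_last_last x
  simp [buildingWeight, h1, h2]

/-- Recursion for the building count of a word all of whose consecutive pairs have weight `w`,
according to the last arrival. -/
lemma buildingCount_succ_succ {w : ℝ} (x : Fin (n + 2) → V)
    (hx : ∀ i : Fin (n + 1), G.weight (x i.castSucc) (x i.succ) = w) :
    G.buildingCount x = w * G.buildingCount (x ∘ Fin.succ) +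
      w ^ 2 * ∑ i : Fin n, G.buildingCount (x ∘ i.castSucc.succ.succAbove) +
      w * G.buildingCount (x ∘ Fin.castSucc) := by
  rw [buildingCount_eq_sum, Fin.sum_univ_succ, Fin.sum_univ_castSucc, ← add_assoc, Finset.mul_sum]
  congr 2
  · simp only [buildingCount, Finset.mul_sum]
    refine Finset.sum_congr rfl fun τ _ => ?_
    rw [buildingWeight_insertLast, leftFactor_insertLast_last_zero]
    have := G.rightFactor_insertLast_last_castSucc x 0 τ
    rw [Fin.castSucc_zero] at this
    rw [this, one_mul]
    congr 1
    exact hx 0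
  · refine Finset.sum_congr rfl fun i _ => ?_
    simp only [buildingCount, Finset.mul_sum]
    refine Finset.sum_congr rfl fun τ _ => ?_
    rw [buildingWeight_insertLast, leftFactor_insertLast_last_succ, hx]
    have := G.rightFactor_insertLast_last_castSucc x i.succ τ
    rw [hx, ← Fin.succ_castSucc] at this
    rw [this, pow_two]
  · simp only [buildingCount, Finset.mul_sum]
    refine Finset.sum_congr rfl fun τ _ => ?_
    rw [buildingWeight_insertLast, leftFactor_insertLast_last_succ, hx, Fin.succ_last,
      rightFactor_insertLast_last_last, mul_one, Fin.succAbove_last]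

end Recursion

end WeightedGraph

/-! ### Deletion sums over words -/

/-- The sum of the values of `f` at the words obtained from a word by deleting one symbol. -/
def delSum {V : Type*} (f : List V → ℝ) : List V → ℝ
  | [] => 0
  | a :: l => f l + delSum (fun m => f (a :: m)) l

section DelSum

variable {V : Type*}

@[simp] lemma delSum_nil (f : List V → ℝ) : delSum f [] = 0 := rfl

@[simp] lemma delSum_cons (f : List V → ℝ) (a : V) (l : List V) :
    delSum f (a :: l) = f l + delSum (fun m => f (a :: m)) l := rfl

lemma delSum_append (f : List V → ℝ) (x y : List V) :
    delSum f (x ++ y) = delSum (fun x' => f (x' ++ y)) x + delSum (fun y' => f (x ++ y')) y := by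
  induction x generalizing f with
  | nil => simp
  | cons a x ih => simp [ih, add_assoc]

lemma delSum_add (f g : List V → ℝ) (l : List V) :
    delSum (fun m => f m + g m) l = delSum f l + delSum g l := by
  induction l generalizing f g with
  | nil => simp
  | cons a l ih => simp only [delSum_cons, ih]; ring

lemma delSum_mul_left (c : ℝ) (f : List V → ℝ) (l : List V) :
    delSum (fun m => c * f m) l = c * delSum f l := by
  induction l generalizing f with
  | nil => simp
  | cons a l ih => simp only [delSum_cons, ih]; ring

lemma delSum_zero (l : List V) : delSum (fun _ => 0) l = 0 := by
  induction l with
  | nil => rfl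
  | cons a l ih => simp [ih]

lemma delSum_sum {ι : Type*} (s : Finset ι) (f : ι → List V → ℝ) (l : List V) :
    delSum (fun m => ∑ i ∈ s, f i m) l = ∑ i ∈ s, delSum (f i) l := by
  classical
  induction s using Finset.induction_on with
  | empty => simp [delSum_zero]
  | insert i s hi ih => simp [Finset.sum_insert hi, delSum_add, ih]

lemma delSum_congr {f g : List V → ℝ} {l : List V}
    (h : ∀ m : List V, m.length + 1 = l.length → f m = g m) : delSum f l = delSum g l := by
  induction l generalizing f g with
  | nil => rfl
  | cons a l ih =>
    rw [delSum_cons, delSum_cons, h l rfl, ih fun m hm => h (a :: m) (by simpa using hm)]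

lemma delSum_reverse (f : List V → ℝ) (l : List V) :
    delSum f l.reverse = delSum (fun m => f m.reverse) l := by
  induction l generalizing f with
  | nil => rfl
  | cons a l ih => simp [delSum_append, ih, add_comm]

lemma sum_eraseIdx_eq_delSum (f : List V → ℝ) (l : List V) :
    ∑ i : Fin l.length, f (l.eraseIdx i) = delSum f l := by
  induction l generalizing f with
  | nil => rfl
  | cons a l ih =>
    simp only [List.length_cons, Fin.sum_univ_succ, delSum_cons, ← ih]
    simp

end DelSum

/-! ### Building counts of lists -/

namespace WeightedGraph

variable {V : Type*} (G : WeightedGraph V)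

/-- The building count of a word given as a list. -/
noncomputable def wordCount (l : List V) : ℝ := G.buildingCount l.get

lemma wordCount_ofFn {n : ℕ} (x : Fin n → V) : G.wordCount (List.ofFn x) = G.buildingCount x := by
  have key : ∀ {m : ℕ} (h : m = n) (y : Fin m → V), (∀ i, y i = x (Fin.cast h i)) →
      G.buildingCount y = G.buildingCount x := by
    rintro m rfl y hy
    exact congrArg _ (funext hy)
  exact key (List.length_ofFn) _ fun i => by simp [Fin.cast]

/-- Adjacency: the edge has nonzero weight. -/
def Adj (a b : V) : Prop := G.weight a b ≠ 0

lemma wordCount_nil : G.wordCount [] = 1 := G.buildingCount_zero _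

lemma wordCount_singleton (a : V) : G.wordCount [a] = 1 := G.buildingCount_one _

lemma wordCount_eq_zero {l : List V} (h : ¬ l.IsChain G.Adj) : G.wordCount l = 0 := by
  rw [List.isChain_iff_getElem] at h
  push Not at h
  obtain ⟨i, hi, h⟩ := h
  exact G.buildingCount_eq_zero _ hi (by simpa [Adj] using h)

lemma ofFn_comp_succAbove {n : ℕ} (x : Fin (n + 1) → V) (i : Fin (n + 1)) :
    List.ofFn (x ∘ i.succAbove) = (List.ofFn x).eraseIdx i := by
  refine List.ext_getElem (by simp [List.length_eraseIdx]; omega) fun j h1 h2 => ?_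
  simp only [List.getElem_ofFn, Function.comp, List.getElem_eraseIdx]
  simp only [List.length_ofFn] at h1
  split_ifs with h
  · rw [Fin.succAbove_of_castSucc_lt _ _ (by simpa [Fin.lt_def] using h)]
    rfl
  · rw [Fin.succAbove_of_le_castSucc _ _ (by simpa [Fin.le_def] using h)]
    rfl

variable {G} {w : ℝ}

namespace HasUniformWeight

lemma weight_eq_of_adj (hG : G.HasUniformWeight w) {a b : V} (h : G.Adj a b) : G.weight a b = w :=
  (hG.eq_zero_or_eq a b).resolve_left h

lemma adj_symm (hG : G.HasUniformWeight w) {a b : V} (h : G.Adj a b) : G.Adj b a := by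
  rwa [Adj, hG.symm]

lemma adj_comm (hG : G.HasUniformWeight w) {a b : V} : G.Adj a b ↔ G.Adj b a :=
  ⟨hG.adj_symm, hG.adj_symm⟩

lemma not_adj_self (hG : G.HasUniformWeight w) (a : V) : ¬ G.Adj a a := by simp [Adj, hG.loopless]

/-- Both end letters are split off because an end arrival meets one neighbour (weight `w`) and an
interior one meets two (`w ^ 2`). -/
lemma wordCount_cons_append (hG : G.HasUniformWeight w) (a b : V) (m : List V)
    (h : (a :: (m ++ [b])).IsChain G.Adj) :
    G.wordCount (a :: (m ++ [b])) = w * G.wordCount (m ++ [b]) + w * G.wordCount (a :: m) +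
      w ^ 2 * delSum (fun m' => G.wordCount (a :: (m' ++ [b]))) m := by
  obtain ⟨x, hx⟩ : ∃ x : Fin (m.length + 2) → V, List.ofFn x = a :: (m ++ [b]) := by
    have h1 : (a :: (m ++ [b])).length = m.length + 2 := by simp
    refine ⟨fun i => (a :: (m ++ [b])).get (i.cast h1.symm), ?_⟩
    refine List.ext_getElem (by simp) fun i _ _ => ?_
    rw [List.getElem_ofFn]
    rfl
  have hw : ∀ i : Fin (m.length + 1), G.weight (x i.castSucc) (x i.succ) = w := by
    rw [← hx, List.isChain_iff_getElem] at h
    intro i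
    have := h i (by simp; omega)
    simp only [List.getElem_ofFn] at this
    exact hG.weight_eq_of_adj this
  rw [← hx, wordCount_ofFn, G.buildingCount_succ_succ x hw, ← sum_eraseIdx_eq_delSum]
  have e0 : m ++ [b] = List.ofFn (x ∘ Fin.succ) := by
    have := ofFn_comp_succAbove x 0
    simp only [hx, Fin.succAbove_zero] at this
    rw [this]; rfl
  have e1 : a :: m = List.ofFn (x ∘ Fin.castSucc) := by
    have := ofFn_comp_succAbove x (Fin.last _)
    rw [Fin.succAbove_last, hx] at this
    rw [this]
    simp [List.eraseIdx_append_of_length_le]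
  have e2 : ∀ i : Fin m.length,
      a :: (m.eraseIdx i ++ [b]) = List.ofFn (x ∘ i.castSucc.succ.succAbove) := by
    intro i
    rw [ofFn_comp_succAbove, hx]
    simp [List.eraseIdx_append_of_lt_length]
  simp only [e0, e1, e2, wordCount_ofFn]
  ring

lemma wordCount_pair (hG : G.HasUniformWeight w) {a b : V} (h : G.Adj a b) :
    G.wordCount [a, b] = 2 * w := by
  have := hG.wordCount_cons_append a b [] (by simpa using h)
  simp only [List.nil_append, wordCount_singleton, delSum_nil] at this
  rw [this]; ring

end HasUniformWeight

end WeightedGraph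

/-! ### Sums over all words of a given length -/

section SumOfFn

variable {V : Type*} [Fintype V]

lemma sum_ofFn_zero (F : List V → ℝ) : ∑ z : Fin 0 → V, F (List.ofFn z) = F [] := by
  simp

lemma sum_ofFn_succ (k : ℕ) (F : List V → ℝ) :
    ∑ z : Fin (k + 1) → V, F (List.ofFn z) = ∑ v, ∑ z : Fin k → V, F (v :: List.ofFn z) := by
  rw [← Fintype.sum_prod_type' (f := fun v (z : Fin k → V) => F (v :: List.ofFn z))]
  refine (Fintype.sum_equiv (Fin.consEquiv fun _ => V) _ _ fun p => ?_).symm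
  simp [Fin.consEquiv]

lemma sum_ofFn_add (m n : ℕ) (F : List V → ℝ) :
    ∑ z : Fin (m + n) → V, F (List.ofFn z) =
      ∑ x : Fin m → V, ∑ y : Fin n → V, F (List.ofFn x ++ List.ofFn y) := by
  induction m generalizing F with
  | zero =>
    rw [Nat.zero_add, sum_ofFn_zero (fun l => ∑ y : Fin n → V, F (l ++ List.ofFn y))]
    simp
  | succ m ih =>
    rw [Nat.add_right_comm, sum_ofFn_succ,
      sum_ofFn_succ m (fun l => ∑ y : Fin n → V, F (l ++ List.ofFn y))]
    exact Finset.sum_congr rfl fun v _ => ih fun l => F (v :: l)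

lemma sum_ofFn_one (F : List V → ℝ) : ∑ z : Fin 1 → V, F (List.ofFn z) = ∑ v, F [v] := by
  rw [sum_ofFn_succ 0 F]
  simp

lemma sum_ofFn_reverse (k : ℕ) (F : List V → ℝ) :
    ∑ z : Fin k → V, F (List.ofFn z).reverse = ∑ z : Fin k → V, F (List.ofFn z) := by
  induction k generalizing F with
  | zero => simp
  | succ k ih =>
    rw [sum_ofFn_succ k fun l => F l.reverse, sum_ofFn_add k 1]
    refine Eq.trans ?_ Finset.sum_comm
    rw [sum_ofFn_one (F := fun l => ∑ x : Fin k → V, F (List.ofFn x ++ l))]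
    refine Finset.sum_congr rfl fun v _ => ?_
    simp only [List.reverse_cons]
    exact ih fun l => F (l ++ [v])

end SumOfFn

/-! ### Gap sums on equipartite graphs -/

namespace WeightedGraph

variable {V : Type*} {G : WeightedGraph V} {w : ℝ}

/-- Counts see letters only through pairwise weights, so replacing letters by twins changes nothing.
-/
lemma wordCount_congr {l l' : List V} (hw : ∀ a b, G.weight a b = G.weight b a)
    (h : List.Forall₂ (fun a b => ∀ c, G.weight a c = G.weight b c) l l') :
    G.wordCount l = G.wordCount l' := by
  obtain ⟨hlen, h⟩ := List.forall₂_iff_get.1 h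
  have hl' : l' = List.ofFn fun i : Fin l.length => l'.get (i.cast hlen) := by
    refine List.ext_getElem (by simp [hlen]) fun i _ _ => ?_
    simp
  rw [hl', wordCount_ofFn, wordCount]
  have key : ∀ i j : Fin l.length, G.weight (l.get i) (l.get j) =
      G.weight (l'.get (i.cast hlen)) (l'.get (j.cast hlen)) := by
    intro i j
    have hi := h i i.2 (hlen ▸ i.2) (l.get j)
    have hj := h j j.2 (hlen ▸ j.2) (l'.get (i.cast hlen))
    exact (hi.trans (hw _ _)).trans (hj.trans (hw _ _))
  simp only [buildingCount, buildingWeight, leftFactor, rightFactor, key]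

namespace HasUniformWeight

/-- At `w = 1` end and interior deletions have equal weight; this is the only recursion that the
equipartite case uses. -/
lemma wordCount_eq_delSum (hG : G.HasUniformWeight 1) {l : List V} (hl : l ≠ [])
    (h : l.IsChain G.Adj) : G.wordCount l = delSum G.wordCount l := by
  cases l with
  | nil => exact absurd rfl hl
  | cons a l =>
    rcases List.eq_nil_or_concat l with rfl | ⟨m, b, rfl⟩
    · simp [wordCount_nil, wordCount_singleton]
    · rw [List.concat_eq_append] at h ⊢
      rw [hG.wordCount_cons_append a b m h]
      simp only [delSum_cons, delSum_append, delSum_nil, List.append_nil]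
      ring

lemma isChain_reverse (hG : G.HasUniformWeight w) {l : List V} :
    l.reverse.IsChain G.Adj ↔ l.IsChain G.Adj := by
  rw [List.isChain_reverse]
  have : (fun a b => G.Adj b a) = G.Adj := by
    funext a b
    exact propext hG.adj_comm
  rw [this]

lemma wordCount_reverse (hG : G.HasUniformWeight 1) (l : List V) :
    G.wordCount l.reverse = G.wordCount l := by
  induction hn : l.length using Nat.strong_induction_on generalizing l with
  | _ n ih =>
    by_cases h : l.IsChain G.Adj
    · rcases eq_or_ne l [] with rfl | hl
      · rfl
      · rw [hG.wordCount_eq_delSum hl h, hG.wordCount_eq_delSum (by simpa using hl)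
          (hG.isChain_reverse.2 h), delSum_reverse]
        exact delSum_congr fun m hm => ih m.length (by omega) m rfl
    · rw [G.wordCount_eq_zero h, G.wordCount_eq_zero fun h' => h (hG.isChain_reverse.1 h')]

end HasUniformWeight

/-- `G` is a complete multipartite graph with edges of weight one and all parts of size `s`:
non-adjacent vertices have the same neighbours, and every vertex has `s` non-neighbours. -/
structure IsEquipartite [Fintype V] (G : WeightedGraph V) (s : ℕ) : Prop where
  uniform : G.HasUniformWeight 1
  adj_iff : ∀ {a b : V}, ¬ G.Adj a b → ∀ c, G.Adj a c ↔ G.Adj b c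
  card_not_adj : ∀ a, Nat.card {b // ¬ G.Adj a b} = s

/-- The sum of the building counts of the words `x z y`, over all words `z` of length `k`. -/
noncomputable def gapSum [Fintype V] (G : WeightedGraph V) (k : ℕ) (x y : List V) : ℝ :=
  ∑ z : Fin k → V, G.wordCount (x ++ List.ofFn z ++ y)

section GapSum

variable [Fintype V]

lemma gapSum_zero (x y : List V) : G.gapSum 0 x y = G.wordCount (x ++ y) := by
  simp [gapSum]

lemma gapSum_succ (k : ℕ) (x y : List V) :
    G.gapSum (k + 1) x y = ∑ v, G.gapSum k (x ++ [v]) y := by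
  rw [gapSum, sum_ofFn_succ k fun z => G.wordCount (x ++ z ++ y)]
  simp [gapSum]

lemma gapSum_one (x y : List V) : G.gapSum 1 x y = ∑ v, G.wordCount (x ++ v :: y) := by
  simp [gapSum_succ, gapSum_zero]

lemma gapSum_eq_zero_left {k : ℕ} {x y : List V} (h : ¬ x.IsChain G.Adj) :
    G.gapSum k x y = 0 :=
  Finset.sum_eq_zero fun _ _ => G.wordCount_eq_zero fun h' => h <| by
    rw [List.append_assoc] at h'
    exact h'.left_of_append

lemma gapSum_eq_zero_right {k : ℕ} {x y : List V} (h : ¬ y.IsChain G.Adj) :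
    G.gapSum k x y = 0 :=
  Finset.sum_eq_zero fun _ _ => G.wordCount_eq_zero fun h' => h h'.right_of_append

lemma HasUniformWeight.gapSum_reverse (hG : G.HasUniformWeight 1) (k : ℕ) (x y : List V) :
    G.gapSum k y.reverse x.reverse = G.gapSum k x y := by
  rw [gapSum, gapSum, ← sum_ofFn_reverse k fun z => G.wordCount (y.reverse ++ z ++ x.reverse)]
  refine Finset.sum_congr rfl fun z _ => ?_
  rw [← hG.wordCount_reverse (x ++ List.ofFn z ++ y)]
  simp

namespace IsEquipartite

open Classical in
lemma sum_not_adj {s : ℕ} (h : G.IsEquipartite s) (a : V) :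
    ∑ v, (if G.Adj a v then (0 : ℝ) else 1) = s := by
  rw [← h.card_not_adj a, Nat.card_eq_fintype_card, Fintype.card_subtype, Finset.card_filter]
  push_cast
  exact Finset.sum_congr rfl fun v _ => by split_ifs <;> simp_all

open Classical in
lemma sum_adj {s : ℕ} (h : G.IsEquipartite s) (a : V) :
    ∑ v, (if G.Adj a v then (1 : ℝ) else 0) = Fintype.card V - s := by
  rw [← h.sum_not_adj a, eq_sub_iff_add_eq, ← Finset.sum_add_distrib]
  rw [Finset.sum_congr rfl fun v _ => show _ = (1 : ℝ) by split_ifs <;> simp]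
  simp

open Classical in
-- The non-neighbours of `a` and of `b` are two disjoint parts, since a common one would make `a`
-- and `b` twins, hence non-adjacent.
lemma sum_adj_adj {s : ℕ} (h : G.IsEquipartite s) {a b : V} (hab : G.Adj a b) :
    ∑ v, (if G.Adj a v ∧ G.Adj v b then (1 : ℝ) else 0) = Fintype.card V - 2 * s := by
  have key : ∀ v, (if G.Adj a v ∧ G.Adj v b then (1 : ℝ) else 0) =
      1 - (if G.Adj a v then (0 : ℝ) else 1) - (if G.Adj b v then (0 : ℝ) else 1) := by
    intro v
    rw [h.uniform.adj_comm (a := v) (b := b)]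
    by_cases h1 : G.Adj a v <;> by_cases h2 : G.Adj b v <;> simp [h1, h2]
    exact absurd ((h.adj_iff h1 b).1 hab) fun h3 => h2 (h.uniform.adj_symm h3)
  simp only [key, Finset.sum_sub_distrib, h.sum_not_adj]
  simp
  ring

lemma wordCount_eq_of_not_adj {s : ℕ} (h : G.IsEquipartite s) {a b : V} (hab : ¬ G.Adj a b)
    (x y : List V) : G.wordCount (x ++ a :: y) = G.wordCount (x ++ b :: y) := by
  have hrefl : ∀ l : List V, List.Forall₂ (fun a b => ∀ c, G.weight a c = G.weight b c) l l :=
    fun l => List.forall₂_same.2 fun _ _ _ => rfl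
  refine wordCount_congr h.uniform.symm (List.rel_append (hrefl x) (.cons (fun c => ?_) (hrefl y)))
  have := h.adj_iff hab c
  by_cases hc : G.Adj a c
  · rw [h.uniform.weight_eq_of_adj hc, h.uniform.weight_eq_of_adj (this.1 hc)]
  · have hc' : ¬ G.Adj b c := fun h' => hc (this.2 h')
    simp only [Adj, not_not] at hc hc'
    rw [hc, hc']

open Classical in
/-- Contribution of the deletions inside the gap. -/
lemma sum_delSum_gap {s : ℕ} (h : G.IsEquipartite s) (k : ℕ) {x y : List V} (hx : x ≠ [])
    (hy : y ≠ []) :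
    ∑ z : Fin k → V, (if (x ++ List.ofFn z ++ y).IsChain G.Adj then
        delSum (fun z' => G.wordCount (x ++ z' ++ y)) (List.ofFn z) else 0) =
      k * (Fintype.card V - 2 * s) * G.gapSum (k - 1) x y := by
  induction k generalizing x with
  | zero => simp
  | succ k ih =>
    refine (sum_ofFn_succ k fun z => if (x ++ z ++ y).IsChain G.Adj then
        delSum (fun z' => G.wordCount (x ++ z' ++ y)) z else 0).trans ?_
    -- Deletion of the first gap letter `v`: if the shortened word is a chain, `v` ranges over the
    -- common neighbours of the letters at the junction; otherwise its count is zero.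
    have h1 : ∑ v, ∑ z : Fin k → V, (if (x ++ v :: List.ofFn z ++ y).IsChain G.Adj then
        G.wordCount (x ++ List.ofFn z ++ y) else 0) =
        (Fintype.card V - 2 * s) * G.gapSum k x y := by
      rw [Finset.sum_comm, gapSum, Finset.mul_sum]
      refine Finset.sum_congr rfl fun z _ => ?_
      generalize List.ofFn z = z
      by_cases hc : (x ++ z ++ y).IsChain G.Adj
      · obtain ⟨x, p, rfl⟩ := (List.eq_nil_or_concat x).resolve_left hx
        obtain ⟨q, r, hqr⟩ := List.exists_cons_of_ne_nil (l := z ++ y) (by simp [hy])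
        simp only [List.concat_eq_append, List.append_assoc, List.cons_append, List.nil_append,
          hqr] at hc ⊢
        rw [List.isChain_append_cons_cons] at hc
        rw [← h.sum_adj_adj hc.2.1, Finset.sum_mul]
        refine Finset.sum_congr rfl fun v _ => ?_
        simp [List.isChain_append_cons_cons, hc.1, hc.2.2]
      · simp only [G.wordCount_eq_zero hc, ite_self, Finset.sum_const_zero, mul_zero]
    -- Deletion of a later gap letter: `v` is absorbed into `x` and induction applies. The truncated
    -- `k - 1` is harmless because of the factor `k`.
    have h2 : ∑ v, ∑ z : Fin k → V, (if (x ++ v :: List.ofFn z ++ y).IsChain G.Adj then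
        delSum (fun z' => G.wordCount (x ++ v :: z' ++ y)) (List.ofFn z) else 0) =
        k * (Fintype.card V - 2 * s) * G.gapSum k x y := by
      have : ∀ v, ∑ z : Fin k → V, (if (x ++ v :: List.ofFn z ++ y).IsChain G.Adj then
          delSum (fun z' => G.wordCount (x ++ v :: z' ++ y)) (List.ofFn z) else 0) =
          k * (Fintype.card V - 2 * s) * G.gapSum (k - 1) (x ++ [v]) y := by
        intro v
        rw [← ih (x := x ++ [v]) (by simp)]
        simp
      simp only [this, ← Finset.mul_sum]
      cases k with
      | zero => simp
      | succ k => rw [Nat.add_sub_cancel, gapSum_succ]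
    rw [Nat.add_sub_cancel, Nat.cast_succ, add_mul, add_mul, ← h2, one_mul, ← h1,
      ← Finset.sum_add_distrib]
    refine Finset.sum_congr rfl fun v _ => ?_
    rw [← Finset.sum_add_distrib]
    refine Finset.sum_congr rfl fun z _ => ?_
    split_ifs
    · rw [delSum_cons, add_comm]
    · simp

open Classical in
/-- Contribution of the deletions to the left of the gap. -/
lemma sum_delSum_left {s : ℕ} (h : G.IsEquipartite s) (k : ℕ) {x y : List V} (hx : x ≠ [])
    (hxc : x.IsChain G.Adj) :
    ∑ z : Fin (k + 1) → V, (if (x ++ List.ofFn z ++ y).IsChain G.Adj then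
        delSum (fun x' => G.wordCount (x' ++ List.ofFn z ++ y)) x else 0) =
      delSum (fun x' => G.gapSum (k + 1) x' y) x - s * G.gapSum k x y := by
  obtain ⟨x, p, rfl⟩ := (List.eq_nil_or_concat x).resolve_left hx
  rw [List.concat_eq_append] at hxc ⊢
  -- The chain condition matters only for the deletion of the last letter `p`. When an earlier
  -- letter goes, `p` still borders the gap, and as `x` is a chain, a chain after deletion comes
  -- from a chain before it.
  have h1 : ∀ z : List V, (if (x ++ [p] ++ z ++ y).IsChain G.Adj then
      delSum (fun x' => G.wordCount (x' ++ z ++ y)) (x ++ [p]) else 0) =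
      delSum (fun x' => G.wordCount (x' ++ [p] ++ z ++ y)) x +
        if (x ++ [p] ++ z ++ y).IsChain G.Adj then G.wordCount (x ++ z ++ y) else 0 := by
    intro z
    split_ifs with hc
    · simp [delSum_append]
    · rw [add_zero, ← delSum_zero x]
      refine delSum_congr fun m _ => (G.wordCount_eq_zero fun hm => hc ?_).symm
      simp only [List.append_assoc, List.cons_append, List.nil_append] at hm ⊢
      rw [List.isChain_split] at hm ⊢
      exact ⟨hxc, hm.2⟩
  -- After `p` is deleted, gaps starting with a non-neighbour `v` of `p` must be removed. Each such
  -- `v` is a twin of `p`, so `x v z y` has the count of `x p z y`.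
  have h2 : ∑ z : Fin (k + 1) → V, (if (x ++ [p] ++ List.ofFn z ++ y).IsChain G.Adj then
      G.wordCount (x ++ List.ofFn z ++ y) else 0) =
      G.gapSum (k + 1) x y - s * G.gapSum k (x ++ [p]) y := by
    refine (sum_ofFn_succ k fun z => if (x ++ [p] ++ z ++ y).IsChain G.Adj then
      G.wordCount (x ++ z ++ y) else 0).trans ?_
    rw [gapSum_succ, ← h.sum_not_adj p, Finset.sum_mul,
      ← Finset.sum_sub_distrib]
    refine Finset.sum_congr rfl fun v _ => ?_
    rw [gapSum, gapSum, Finset.mul_sum, ← Finset.sum_sub_distrib]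
    refine Finset.sum_congr rfl fun z _ => ?_
    generalize List.ofFn z = z
    by_cases hc : (x ++ v :: (z ++ y)).IsChain G.Adj
    · by_cases hpv : G.Adj p v
      · have : (x ++ p :: v :: (z ++ y)).IsChain G.Adj :=
          List.isChain_append_cons_cons.2 ⟨hxc, hpv, (List.isChain_split.1 hc).2⟩
        simp [hpv, this]
      · have : ¬ (x ++ p :: v :: (z ++ y)).IsChain G.Adj := fun h' =>
          hpv (List.isChain_append_cons_cons.1 h').2.1
        simp [hpv, this, h.wordCount_eq_of_not_adj hpv x (z ++ y)]
    · by_cases hpv : G.Adj p v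
      · simp [hpv, G.wordCount_eq_zero hc]
      · have : ¬ (x ++ p :: v :: (z ++ y)).IsChain G.Adj := fun h' =>
          hpv (List.isChain_append_cons_cons.1 h').2.1
        simp [hpv, this, h.wordCount_eq_of_not_adj hpv x (z ++ y)]
  rw [Finset.sum_congr rfl fun z _ => h1 (List.ofFn z), Finset.sum_add_distrib, h2, delSum_append,
    ← delSum_sum]
  simp [gapSum]
  ring

open Classical in
lemma sum_delSum_right {s : ℕ} (h : G.IsEquipartite s) (k : ℕ) {x y : List V} (hy : y ≠ [])
    (hyc : y.IsChain G.Adj) :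
    ∑ z : Fin (k + 1) → V, (if (x ++ List.ofFn z ++ y).IsChain G.Adj then
        delSum (fun y' => G.wordCount (x ++ List.ofFn z ++ y')) y else 0) =
      delSum (fun y' => G.gapSum (k + 1) x y') y - s * G.gapSum k x y := by
  have := h.sum_delSum_left k (x := y.reverse) (y := x.reverse) (by simpa using hy)
    (h.uniform.isChain_reverse.2 hyc)
  simp only [delSum_reverse, h.uniform.gapSum_reverse] at this
  rw [← this]
  refine Eq.trans ?_ (sum_ofFn_reverse (k + 1) fun z =>
    if (y.reverse ++ z ++ x.reverse).IsChain G.Adj then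
      delSum (fun m => G.wordCount (m.reverse ++ z ++ x.reverse)) y else 0)
  refine Finset.sum_congr rfl fun z _ => ?_
  have e : ∀ m : List V, m.reverse ++ (List.ofFn z).reverse ++ x.reverse =
      (x ++ List.ofFn z ++ m).reverse := by simp
  simp only [e, h.uniform.isChain_reverse, h.uniform.wordCount_reverse]

/-- Recursion for the gap sums. -/
lemma gapSum_rec {s : ℕ} (h : G.IsEquipartite s) (k : ℕ) {x y : List V} (hx : x ≠ [])
    (hy : y ≠ []) (hxc : x.IsChain G.Adj) (hyc : y.IsChain G.Adj) :
    G.gapSum (k + 1) x y = delSum (fun x' => G.gapSum (k + 1) x' y) x +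
      delSum (fun y' => G.gapSum (k + 1) x y') y +
      ((k + 1) * (Fintype.card V - 2 * s) - 2 * s) * G.gapSum k x y := by
  classical
  have h1 := h.sum_delSum_left k (y := y) hx hxc
  have h2 := h.sum_delSum_gap (k + 1) hx hy
  have h3 := h.sum_delSum_right k (x := x) hy hyc
  have : G.gapSum (k + 1) x y = ∑ z : Fin (k + 1) → V,
      ((if (x ++ List.ofFn z ++ y).IsChain G.Adj then
        delSum (fun x' => G.wordCount (x' ++ List.ofFn z ++ y)) x else 0) +
      (if (x ++ List.ofFn z ++ y).IsChain G.Adj then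
        delSum (fun z' => G.wordCount (x ++ z' ++ y)) (List.ofFn z) else 0) +
      (if (x ++ List.ofFn z ++ y).IsChain G.Adj then
        delSum (fun y' => G.wordCount (x ++ List.ofFn z ++ y')) y else 0)) := by
    refine Finset.sum_congr rfl fun z _ => ?_
    generalize List.ofFn z = z
    split_ifs with hc
    · rw [h.uniform.wordCount_eq_delSum (by simp [hx]) hc, delSum_append, delSum_append]
    · rw [G.wordCount_eq_zero hc, add_zero, add_zero]
  rw [this, Finset.sum_add_distrib, Finset.sum_add_distrib, h1, h2, h3, Nat.add_sub_cancel]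
  push_cast
  ring

/-- Deleting the appended letter gives `N - s` copies of the word, and deletion of the last letter
of `x` loses `s`; the rest is induction. The factor depends on the length only, which is what
consistency needs. -/
lemma gapSum_one_nil {s : ℕ} (h : G.IsEquipartite s) (x : List V) :
    G.gapSum 1 x [] = (Fintype.card V + x.length * (Fintype.card V - 2 * s)) * G.wordCount x := by
  classical
  induction hn : x.length generalizing x with
  | zero =>
    obtain rfl := List.length_eq_zero_iff.1 hn
    simp [gapSum_one, wordCount_nil, wordCount_singleton]
  | succ n ih =>
    by_cases hxc : x.IsChain G.Adj
    · have hx : x ≠ [] := by rintro rfl; simp at hn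
      have h1 := h.sum_delSum_left 0 (y := []) hx hxc
      have h2 : ∑ z : Fin 1 → V, (if (x ++ List.ofFn z ++ []).IsChain G.Adj then
          G.wordCount x else 0) = (Fintype.card V - s) * G.wordCount x := by
        refine (sum_ofFn_one (F := fun z => if (x ++ z ++ []).IsChain G.Adj then
          G.wordCount x else 0)).trans ?_
        obtain ⟨x, p, rfl⟩ := (List.eq_nil_or_concat x).resolve_left hx
        rw [← h.sum_adj p, Finset.sum_mul]
        refine Finset.sum_congr rfl fun v _ => ?_
        rw [List.concat_eq_append] at hxc
        simp [List.isChain_append_cons_cons, hxc]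
      have h3 : G.gapSum 1 x [] = ∑ z : Fin 1 → V,
          ((if (x ++ List.ofFn z ++ []).IsChain G.Adj then
            delSum (fun x' => G.wordCount (x' ++ List.ofFn z ++ [])) x else 0) +
          (if (x ++ List.ofFn z ++ []).IsChain G.Adj then G.wordCount x else 0)) := by
        refine Finset.sum_congr rfl fun z _ => ?_
        split_ifs with hc
        · rw [h.uniform.wordCount_eq_delSum (by simp [hx]) hc]
          simp [delSum_append]
        · rw [G.wordCount_eq_zero hc, add_zero]
      rw [h3, Finset.sum_add_distrib, h1, h2, zero_add, gapSum_zero, List.append_nil,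
        delSum_congr (g := fun m => (Fintype.card V + n * (Fintype.card V - 2 * s)) *
          G.wordCount m) fun m hm => ih m (by omega), delSum_mul_left,
        ← h.uniform.wordCount_eq_delSum hx hxc]
      push_cast
      ring
    · rw [gapSum_eq_zero_left hxc, G.wordCount_eq_zero hxc, mul_zero]

end IsEquipartite

end GapSum

end WeightedGraph

/-! ### Consistency and decoupling for equipartite graphs -/

namespace WeightedGraph

variable {V : Type*} [Fintype V] {G : WeightedGraph V}

/-- The normalizing sum of the insertion algorithm. -/
noncomputable def total (G : WeightedGraph V) (n : ℕ) : ℝ :=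
  ∑ x : Fin n → V, G.wordCount (List.ofFn x)

lemma insertionProb_eq {n : ℕ} (x : Fin n → V) :
    G.insertionProb x = G.wordCount (List.ofFn x) / G.total n := by
  simp only [insertionProb, total, wordCount_ofFn]

lemma total_zero : G.total 0 = 1 := by
  simp [total, wordCount_nil]

lemma total_one : G.total 1 = Fintype.card V := by
  rw [total, sum_ofFn_one G.wordCount]
  simp [wordCount_singleton]

lemma ofFn_snoc {V : Type*} {n : ℕ} (x : Fin n → V) (v : V) :
    List.ofFn (Fin.snoc x v : Fin (n + 1) → V) = List.ofFn x ++ [v] := by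
  rw [List.ofFn_succ', List.concat_eq_append]
  simp

lemma total_succ (n : ℕ) :
    G.total (n + 1) = ∑ x : Fin n → V, G.gapSum 1 (List.ofFn x) [] := by
  rw [total, sum_ofFn_add n 1]
  simp only [gapSum_one]
  exact Finset.sum_congr rfl fun x _ =>
    sum_ofFn_one (F := fun l => G.wordCount (List.ofFn x ++ l))

lemma sum_gapSum (k m n : ℕ) :
    ∑ x : Fin m → V, ∑ y : Fin n → V, G.gapSum k (List.ofFn x) (List.ofFn y) =
      G.total (m + k + n) := by
  rw [total, sum_ofFn_add (m + k) n, sum_ofFn_add m k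
    (fun l => ∑ y : Fin n → V, G.wordCount (l ++ List.ofFn y))]
  refine Finset.sum_congr rfl fun x _ => ?_
  rw [Finset.sum_comm]
  rfl

namespace IsEquipartite

lemma exists_gapSum_nil {s : ℕ} (h : G.IsEquipartite s) (k m : ℕ) :
    ∃ c : ℝ, ∀ x : List V, x.length = m → G.gapSum k x [] = c * G.wordCount x := by
  induction k generalizing m with
  | zero => exact ⟨1, fun x _ => by simp [gapSum_zero]⟩
  | succ k ih =>
    obtain ⟨c, hc⟩ := ih (m + 1)
    refine ⟨c * (Fintype.card V + m * (Fintype.card V - 2 * s)), fun x hx => ?_⟩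
    have := h.gapSum_one_nil x
    rw [gapSum_succ, Finset.sum_congr rfl fun v _ => hc (x ++ [v]) (by simp [hx]),
      ← Finset.mul_sum, ← gapSum_one, this, hx, mul_assoc]

lemma gapSum_nil_left {s : ℕ} (h : G.IsEquipartite s) (k : ℕ) (y : List V) :
    G.gapSum k [] y = G.gapSum k y.reverse [] := by
  rw [← h.uniform.gapSum_reverse k [] y, List.reverse_nil]

/-- If `(k + 1) (|V| - 2 s) = 2 s`, then words separated by a gap of length `k + 1` decouple. -/
lemma exists_gapSum_eq_mul {s k : ℕ} (h : G.IsEquipartite s)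
    (hk : ((k : ℝ) + 1) * (Fintype.card V - 2 * s) = 2 * s) (m n : ℕ) :
    ∃ c : ℝ, ∀ x y : List V, x.length = m → y.length = n →
      G.gapSum (k + 1) x y = c * (G.wordCount x * G.wordCount y) := by
  induction m generalizing n with
  | zero =>
    obtain ⟨c, hc⟩ := h.exists_gapSum_nil (k + 1) n
    refine ⟨c, fun x y hx hy => ?_⟩
    obtain rfl := List.length_eq_zero_iff.1 hx
    rw [h.gapSum_nil_left, hc _ (by simpa using hy), h.uniform.wordCount_reverse, wordCount_nil,
      one_mul]
  | succ m ihm =>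
    induction n with
    | zero =>
      obtain ⟨c, hc⟩ := h.exists_gapSum_nil (k + 1) (m + 1)
      refine ⟨c, fun x y hx hy => ?_⟩
      obtain rfl := List.length_eq_zero_iff.1 hy
      rw [hc x hx, wordCount_nil, mul_one]
    | succ n ihn =>
      obtain ⟨c, hc⟩ := ihm (n + 1)
      obtain ⟨c', hc'⟩ := ihn
      -- The last term of `gapSum_rec` vanishes by `hk`; the two deletion sums reproduce `B(x) B(y)`
      -- with the constants of the lengths `(m, n + 1)` and `(m + 1, n)`.
      refine ⟨c + c', fun x y hx hy => ?_⟩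
      by_cases hxc : x.IsChain G.Adj
      swap; · rw [gapSum_eq_zero_left hxc, G.wordCount_eq_zero hxc, zero_mul, mul_zero]
      by_cases hyc : y.IsChain G.Adj
      swap; · rw [gapSum_eq_zero_right hyc, G.wordCount_eq_zero hyc, mul_zero, mul_zero]
      have hx0 : x ≠ [] := by rintro rfl; simp at hx
      have hy0 : y ≠ [] := by rintro rfl; simp at hy
      rw [h.gapSum_rec k hx0 hy0 hxc hyc, hk, sub_self, zero_mul, add_zero,
        delSum_congr (g := fun x' => c * G.wordCount y * G.wordCount x') fun x' hx' => by
          rw [hc x' y (by omega) hy]; ring,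
        delSum_congr (l := y) (g := fun y' => c' * G.wordCount x * G.wordCount y')
          fun y' hy' => by rw [hc' x y' hx (by omega)]; ring,
        delSum_mul_left, delSum_mul_left, ← h.uniform.wordCount_eq_delSum hx0 hxc,
        ← h.uniform.wordCount_eq_delSum hy0 hyc]
      ring

lemma total_succ_eq {s : ℕ} (h : G.IsEquipartite s) (n : ℕ) :
    G.total (n + 1) = (Fintype.card V + n * (Fintype.card V - 2 * s)) * G.total n := by
  rw [WeightedGraph.total_succ, total, Finset.mul_sum]
  exact Finset.sum_congr rfl fun x _ => by rw [h.gapSum_one_nil, List.length_ofFn]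

lemma total_pos {s : ℕ} (h : G.IsEquipartite s) [Nonempty V] (hs : 2 * s ≤ Fintype.card V)
    (n : ℕ) : 0 < G.total n := by
  have h1 : (0 : ℝ) < Fintype.card V := by exact_mod_cast Fintype.card_pos
  have h2 : (0 : ℝ) ≤ Fintype.card V - 2 * s := by
    rw [sub_nonneg]; exact_mod_cast hs
  induction n with
  | zero => simp [total_zero]
  | succ n ih =>
    rw [h.total_succ_eq]
    positivity

lemma isConsistent {s : ℕ} (h : G.IsEquipartite s) [Nonempty V]
    (hs : 2 * s ≤ Fintype.card V) : G.IsConsistent := by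
  intro n x
  have h0 := (h.total_pos hs n).ne'
  have h1 := (h.total_pos hs (n + 1)).ne'
  have key : G.insertionProb x = G.gapSum 1 (List.ofFn x) [] / G.total (n + 1) := by
    have h2 := h.total_succ_eq n
    have h3 : (Fintype.card V + n * (Fintype.card V - 2 * s) : ℝ) ≠ 0 := by
      intro h3
      rw [h2, h3, zero_mul] at h1
      exact h1 rfl
    rw [insertionProb_eq, h.gapSum_one_nil, List.length_ofFn, h2]
    field_simp
  constructor
  · simp only [key, insertionProb_eq, ofFn_snoc, gapSum_one, Finset.sum_div]
  · have : G.gapSum 1 (List.ofFn x) [] = G.gapSum 1 [] (List.ofFn x) := by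
      rw [h.gapSum_nil_left, h.gapSum_one_nil, h.gapSum_one_nil, h.uniform.wordCount_reverse,
        List.length_reverse]
    rw [key, this]
    simp only [insertionProb_eq, List.ofFn_cons, gapSum_one, Finset.sum_div, List.nil_append]

/-- Decoupling of the insertion probabilities at distance `k + 1`. -/
lemma sum_insertionProb_eq_mul {s k : ℕ} (h : G.IsEquipartite s) [Nonempty V]
    (hs : 2 * s ≤ Fintype.card V)
    (hk : ((k : ℝ) + 1) * (Fintype.card V - 2 * s) = 2 * s) {m n : ℕ} (x : Fin m → V)
    (y : Fin n → V) :
    G.gapSum (k + 1) (List.ofFn x) (List.ofFn y) / G.total (m + (k + 1) + n) =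
      G.insertionProb x * G.insertionProb y := by
  obtain ⟨c, hc⟩ := h.exists_gapSum_eq_mul hk m n
  have hc' : ∀ (x : Fin m → V) (y : Fin n → V), G.gapSum (k + 1) (List.ofFn x) (List.ofFn y) =
      c * (G.wordCount (List.ofFn x) * G.wordCount (List.ofFn y)) :=
    fun x y => hc _ _ (by simp) (by simp)
  have hm := (h.total_pos hs m).ne'
  have hn := (h.total_pos hs n).ne'
  have ht := (h.total_pos hs (m + (k + 1) + n)).ne'
  -- Summation over all `x` and `y` identifies the unknown constant `c`.
  have htot : G.total (m + (k + 1) + n) = c * (G.total m * G.total n) := by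
    rw [← sum_gapSum]
    simp only [hc', total, ← Finset.mul_sum, ← Finset.sum_mul]
  have hc0 : c ≠ 0 := by
    rintro rfl
    rw [zero_mul] at htot
    exact ht htot
  rw [hc', htot, insertionProb_eq, insertionProb_eq]
  field_simp

/-- If the symbols at distance `k + 1` are independent, then some gap length at most `k`
decouples all words. -/
lemma exists_mul_eq {s k : ℕ} (h : G.IsEquipartite s) {a c : V} (hac : G.Adj a c)
    (hk : G.gapSum k [a] [a] = G.gapSum k [a] [c]) :
    ∃ j : ℕ, 1 ≤ j ∧ j ≤ k ∧ (j : ℝ) * (Fintype.card V - 2 * s) = 2 * s := by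
  by_contra! hj
  have key : ∀ i ≤ k, G.gapSum i [a] [a] - G.gapSum i [a] [c] ≠ 0 := by
    intro i hi
    induction i with
    | zero =>
      have h0 : G.wordCount [a, a] = 0 := G.wordCount_eq_zero fun h' => by
        simp [h.uniform.not_adj_self] at h'
      simp [gapSum_zero, h0, h.uniform.wordCount_pair hac]
    | succ i ih =>
      obtain ⟨C, hC⟩ := h.exists_gapSum_nil (i + 1) 1
      -- The two boundary terms do not depend on `b`, so they cancel in the difference, which is
      -- multiplied by a nonzero factor at each step.
      have hrec : ∀ b, G.gapSum (i + 1) [a] [b] =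
          2 * C + ((i + 1) * (Fintype.card V - 2 * s) - 2 * s) * G.gapSum i [a] [b] := by
        intro b
        rw [h.gapSum_rec i (by simp) (by simp) (by simp) (by simp)]
        simp [h.gapSum_nil_left _ [b], hC, wordCount_singleton]
        ring
      rw [hrec, hrec, add_sub_add_left_eq_sub, ← mul_sub]
      refine mul_ne_zero (sub_ne_zero.2 ?_) (ih (by omega))
      have := hj (i + 1) (by omega) hi
      push_cast at this
      exact this
  exact key k le_rfl (sub_eq_zero.2 hk)

end IsEquipartite

lemma isIsomorphic_completeMultipartite_iff {V : Type*} {G : WeightedGraph V} {q r : ℕ} :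
    G.IsIsomorphic (completeMultipartite q r) ↔
      ∃ e : V ≃ Fin r × Fin q, ∀ i j,
        G.weight i j = if (e i).2 ≠ (e j).2 then 1 else 0 := by
  -- `finProdFinEquiv` sends `(i, j)` to `j + q * i`, so the residue modulo `q` is the second
  -- coordinate.
  let E : Fin r × Fin q ≃ Fin (q * r) := finProdFinEquiv.trans (finCongr (mul_comm r q))
  have hE : ∀ p, (E p : ℕ) % q = p.2 := by
    intro p
    simp [E, Nat.mod_eq_of_lt p.2.2]
  constructor
  · rintro ⟨e, he⟩
    refine ⟨e.trans E.symm, fun i j => ?_⟩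
    have h1 := hE (E.symm (e i))
    have h2 := hE (E.symm (e j))
    rw [Equiv.apply_symm_apply] at h1 h2
    simp only [he, completeMultipartite, h1, h2, Equiv.trans_apply, ne_eq, Fin.val_inj]
    congr
  · rintro ⟨e, he⟩
    refine ⟨e.trans E, fun i j => ?_⟩
    simp only [he, completeMultipartite, hE, Equiv.trans_apply, ne_eq, Fin.val_inj]

lemma isEquipartite_of_isIsomorphic {q r : ℕ}
    (h : G.IsIsomorphic (completeMultipartite q r)) :
    G.IsEquipartite r ∧ Fintype.card V = q * r := by
  obtain ⟨e, he⟩ := isIsomorphic_completeMultipartite_iff.1 h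
  have hadj : ∀ a b, G.Adj a b ↔ (e a).2 ≠ (e b).2 := fun a b => by simp [Adj, he]
  refine ⟨⟨⟨one_pos, fun i j => ?_, fun i j => ?_, fun i => ?_⟩, fun {a b} hab c => ?_,
    fun a => ?_⟩, ?_⟩
  · rw [he]; split_ifs <;> simp
  · rw [he, he]; simp only [ne_eq, eq_comm]
  · simp [he]
  · rw [hadj, not_not] at hab
    rw [hadj, hadj, hab]
  · have e1 : {b // ¬ G.Adj a b} ≃ Fin r :=
      { toFun := fun b => (e b).1
        invFun := fun i => ⟨e.symm (i, (e a).2), by simp [hadj]⟩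
        left_inv := fun b => by
          have := b.2
          rw [hadj, not_not] at this
          ext
          simp [this]
        right_inv := fun i => by simp }
    rw [Nat.card_congr e1, Nat.card_eq_fintype_card, Fintype.card_fin]
  · rw [Fintype.card_congr e]
    simp [mul_comm]

/-- A graph as in `IsEquipartite` is a complete multipartite graph. -/
lemma IsEquipartite.exists_isIsomorphic {s : ℕ} (h : G.IsEquipartite s) [Nonempty V] :
    ∃ q : ℕ, 1 ≤ s ∧ Fintype.card V = q * s ∧ G.IsIsomorphic (completeMultipartite q s) := by
  classical
  -- The parts are the classes of non-adjacency, which is transitive because non-adjacent vertices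
  -- are twins.
  let S : Setoid V :=
    { r := fun a b => ¬ G.Adj a b
      iseqv := ⟨h.uniform.not_adj_self, fun hab hba => hab (h.uniform.adj_symm hba),
        fun hab hbc hac => hbc ((h.adj_iff hab _).1 hac)⟩ }
  have hS : ∀ a b, (Quotient.mk S a = Quotient.mk S b) ↔ ¬ G.Adj a b := fun a b => Quotient.eq
  have hfib : ∀ c : Quotient S, Nonempty ({b // Quotient.mk S b = c} ≃ Fin s) := by
    intro c
    obtain ⟨a, rfl⟩ := Quotient.exists_rep c
    refine ⟨(Equiv.subtypeEquivRight fun b => ?_).trans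
      (Finite.equivFinOfCardEq (h.card_not_adj a))⟩
    rw [eq_comm]
    exact hS a b
  let e : V ≃ Fin s × Fin (Fintype.card (Quotient S)) :=
    ((Equiv.sigmaFiberEquiv (Quotient.mk S)).symm.trans
      (Equiv.sigmaCongrRight fun c => (hfib c).some)).trans
      (((Equiv.sigmaEquivProd _ _).trans (Equiv.prodComm _ _)).trans
        (Equiv.prodCongr (Equiv.refl _) (Fintype.equivFin _)))
  have he : ∀ a, (e a).2 = Fintype.equivFin _ (Quotient.mk S a) := fun a => rfl
  refine ⟨Fintype.card (Quotient S), ?_, ?_, isIsomorphic_completeMultipartite_iff.2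
    ⟨e, fun i j => ?_⟩⟩
  · exact (e (Classical.arbitrary V)).1.pos
  · rw [Fintype.card_congr e]
    simp [mul_comm]
  · simp only [he, ne_eq, EmbeddingLike.apply_eq_iff_eq, hS, not_not]
    split_ifs with hij
    · exact h.uniform.weight_eq_of_adj hij
    · simpa [Adj] using hij

end WeightedGraph

/-! ### Powers of a regular adjacency matrix -/

section MatrixPowers

variable {V : Type*} [Fintype V] {A : Matrix V V ℝ} {d : ℝ}

lemma sum_matrix_pow_apply [DecidableEq V] (hd : ∀ a, ∑ c, A a c = d) (m : ℕ) (a : V) :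
    ∑ c, (A ^ m) a c = d ^ m := by
  induction m with
  | zero => simp [Matrix.one_apply]
  | succ m ih =>
    simp only [pow_succ, Matrix.mul_apply]
    rw [Finset.sum_comm]
    simp only [← Finset.mul_sum, hd, ← Finset.sum_mul, ih]

/-- If the entries of the square of a symmetric matrix with constant row sums are all equal,
then so are the entries of the matrix. -/
lemma eq_const_of_mul_self_eq_const [Nonempty V] {S : Matrix V V ℝ} {e κ : ℝ}
    (hS : ∀ a b, S a b = S b a) (he : ∀ a, ∑ c, S a c = e) (h : ∀ a b, (S * S) a b = κ)
    (a b : V) : S a b = e / Fintype.card V := by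
  have hN : (Fintype.card V : ℝ) ≠ 0 := by simp
  have hκ : Fintype.card V * κ = e ^ 2 := by
    have : ∑ c, (S * S) a c = e ^ 2 := by
      simp only [Matrix.mul_apply]
      rw [Finset.sum_comm]
      simp only [← Finset.mul_sum, he, ← Finset.sum_mul, pow_two]
    simpa [h] using this
  -- The squared deviations of a row from its mean add up to `κ - e ^ 2 / |V|`, which is zero by
  -- `hκ`.
  have h0 : ∑ c, (S a c - e / Fintype.card V) ^ 2 = 0 := by
    have h1 : ∑ c, S a c ^ 2 = κ := by
      rw [← h a a, Matrix.mul_apply]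
      exact Finset.sum_congr rfl fun c _ => by rw [pow_two, hS c a]
    simp only [sub_sq, Finset.sum_add_distrib, Finset.sum_sub_distrib, h1, mul_assoc,
      ← Finset.mul_sum, ← Finset.sum_mul, he, Finset.sum_const, Finset.card_univ, nsmul_eq_mul]
    field_simp
    linarith
  have h2 := (Finset.sum_eq_zero_iff_of_nonneg fun c _ => sq_nonneg _).1 h0 b (Finset.mem_univ b)
  exact sub_eq_zero.1 (pow_eq_zero_iff two_ne_zero |>.1 h2)

/-- No positive power of the adjacency matrix of a nonempty regular graph is constant. -/
lemma not_matrix_pow_eq_const [DecidableEq V] [Nonempty V] (hA : ∀ a b, A a b = A b a)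
    (hdiag : ∀ a, A a a = 0) (hd : ∀ a, ∑ c, A a c = d) (hd0 : d ≠ 0) {m : ℕ} (hm : 1 ≤ m) :
    ¬ ∃ κ, ∀ a b, (A ^ m) a b = κ := by
  induction m using Nat.strong_induction_on with
  | _ m ih =>
    rintro ⟨κ, h⟩
    rcases hm.eq_or_lt with rfl | hm1
    · simp only [pow_one] at h
      have a := Classical.arbitrary V
      have h0 : κ = 0 := by rw [← h a a, hdiag]
      apply hd0
      rw [← hd a, Finset.sum_eq_zero fun c _ => by rw [h, h0]]
    · have hsymm : ∀ j a b, (A ^ j) a b = (A ^ j) b a := by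
        intro j a b
        have hT : A.transpose = A := Matrix.ext fun a b => hA b a
        have : (A ^ j).transpose = A ^ j := by rw [Matrix.transpose_pow, hT]
        exact (congrFun (congrFun this b) a)
      -- Descent with `S = A ^ (m - 1)`: its square is `A ^ m * A ^ (m - 2)`, a constant matrix
      -- times one with constant column sums.
      refine ih (m - 1) (by omega) (by omega) ⟨_, eq_const_of_mul_self_eq_const
        (κ := κ * d ^ (m - 2)) (hsymm (m - 1)) (sum_matrix_pow_apply hd (m - 1)) fun a b => ?_⟩
      rw [← pow_add, show m - 1 + (m - 1) = m + (m - 2) by omega, pow_add, Matrix.mul_apply]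
      simp only [h, ← Finset.mul_sum]
      rw [Finset.sum_congr rfl fun c _ => hsymm (m - 2) c b, sum_matrix_pow_apply hd]

end MatrixPowers

/-! ### Local consequences of consistency -/

namespace WeightedGraph

variable {V : Type*} {G : WeightedGraph V} {w : ℝ}

open Classical in
/-- The indicator of adjacency. -/
noncomputable def adjInd (G : WeightedGraph V) (a b : V) : ℝ := if G.Adj a b then 1 else 0

lemma adjInd_of_adj {a b : V} (h : G.Adj a b) : G.adjInd a b = 1 := if_pos h

lemma adjInd_of_not_adj {a b : V} (h : ¬ G.Adj a b) : G.adjInd a b = 0 := if_neg h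

lemma adjInd_nonneg (a b : V) : 0 ≤ G.adjInd a b := by
  rw [adjInd]; split_ifs <;> simp

lemma adjInd_le_one (a b : V) : G.adjInd a b ≤ 1 := by
  rw [adjInd]; split_ifs <;> simp

lemma adjInd_mul_self (a b : V) : G.adjInd a b * G.adjInd a b = G.adjInd a b := by
  rw [adjInd]; split_ifs <;> simp

namespace HasUniformWeight

lemma adjInd_comm (hG : G.HasUniformWeight w) (a b : V) : G.adjInd a b = G.adjInd b a := by
  classical
  simp only [adjInd, if_congr (hG.adj_comm (a := a) (b := b)) rfl rfl]

lemma wordCount_two (hG : G.HasUniformWeight w) (a b : V) :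
    G.wordCount [a, b] = 2 * w * G.adjInd a b := by
  by_cases h : G.Adj a b
  · rw [hG.wordCount_pair h, adjInd_of_adj h, mul_one]
  · rw [adjInd_of_not_adj h, mul_zero, G.wordCount_eq_zero (by simpa using h)]

lemma wordCount_three (hG : G.HasUniformWeight w) (a b c : V) :
    G.wordCount [a, b, c] =
      G.adjInd a b * G.adjInd b c * (4 * w ^ 2 + 2 * w ^ 3 * G.adjInd a c) := by
  by_cases h : G.Adj a b ∧ G.Adj b c
  · have := hG.wordCount_cons_append a c [b] (by simpa using h)
    simp only [List.cons_append, List.nil_append, delSum_cons, delSum_nil, wordCount_two hG,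
      adjInd_of_adj h.1, adjInd_of_adj h.2] at this
    rw [this, adjInd_of_adj h.1, adjInd_of_adj h.2]
    ring
  · rw [G.wordCount_eq_zero (by simpa using h)]
    rcases not_and_or.1 h with h | h <;> simp [adjInd_of_not_adj h]

lemma wordCount_four (hG : G.HasUniformWeight w) {a b c : V} (f : V) (h1 : G.Adj a b)
    (h2 : G.Adj b c) :
    G.wordCount [a, b, c, f] = G.adjInd c f * (8 * w ^ 3 +
      2 * w ^ 4 * G.adjInd b f + 2 * w ^ 4 * G.adjInd a c +
      (4 * w ^ 4 + 2 * w ^ 5 * G.adjInd a f) * (G.adjInd a c + G.adjInd b f)) := by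
  by_cases h : G.Adj c f
  · have := hG.wordCount_cons_append a f [b, c] (by simp [h1, h2, h])
    simp only [List.cons_append, List.nil_append, delSum_cons, delSum_nil, wordCount_three hG,
      adjInd_of_adj h1, adjInd_of_adj h2, adjInd_of_adj h] at this
    rw [this, adjInd_of_adj h]
    ring
  · rw [G.wordCount_eq_zero (by simp [h]), adjInd_of_not_adj h, zero_mul]

end HasUniformWeight

variable [Fintype V]

/-- The properties of the local structure that follow from consistency. -/
structure IsEdgeRegular (G : WeightedGraph V) (d t : ℝ) : Prop where
  degree : ∀ a, ∑ v, G.adjInd a v = d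
  codegree : ∀ a b, G.Adj a b → ∑ v, G.adjInd a v * G.adjInd b v = t

namespace IsConsistent

lemma nonempty (h : G.IsConsistent) : Nonempty V := by
  by_contra hV
  rw [not_nonempty_iff] at hV
  have := (h 0 Fin.elim0).1
  simp [insertionProb_eq, total_zero, wordCount_nil] at this

lemma sum_insertionProb (h : G.IsConsistent) (n : ℕ) :
    ∑ x : Fin n → V, G.insertionProb x = 1 := by
  induction n with
  | zero => simp [insertionProb_eq, total_zero, wordCount_nil]
  | succ n ih =>
    rw [← ih, Finset.sum_congr rfl fun x _ => (h n x).1]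
    simp only [insertionProb_eq, ofFn_snoc]
    rw [← Finset.sum_div, ← total, WeightedGraph.total_succ]
    simp only [gapSum_one, Finset.sum_div]

lemma total_ne_zero (h : G.IsConsistent) (n : ℕ) : G.total n ≠ 0 := by
  intro h0
  have := h.sum_insertionProb n
  simp [insertionProb_eq, h0] at this

lemma exists_sum_wordCount (h : G.IsConsistent) (n : ℕ) :
    ∃ C : ℝ, C ≠ 0 ∧ ∀ x : List V, x.length = n →
      ∑ v, G.wordCount (x ++ [v]) = C * G.wordCount x := by
  refine ⟨G.total (n + 1) / G.total n, div_ne_zero (h.total_ne_zero _) (h.total_ne_zero _), ?_⟩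
  rintro x rfl
  have h1 := (h x.length x.get).1
  simp only [insertionProb_eq, ofFn_snoc, List.ofFn_get, ← Finset.sum_div] at h1
  have h2 := h.total_ne_zero x.length
  have h3 := h.total_ne_zero (x.length + 1)
  field_simp at h1 ⊢
  linarith

/-- Consistency says that appending a letter in all ways multiplies the count by a constant. For
`[a]` this fixes the degree of `a`; for an edge `[a, b]` it then fixes the codegree. -/
lemma exists_isEdgeRegular (h : G.IsConsistent) (hG : G.HasUniformWeight w) :
    ∃ d t : ℝ, 0 < d ∧ 0 ≤ t ∧ G.IsEdgeRegular d t := by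
  have hw := hG.pos
  obtain ⟨a₀⟩ := h.nonempty
  obtain ⟨C₁, hC₁, h1⟩ := h.exists_sum_wordCount 1
  obtain ⟨C₂, -, h2⟩ := h.exists_sum_wordCount 2
  have hdeg : ∀ a, ∑ v, G.adjInd a v = C₁ / (2 * w) := by
    intro a
    have := h1 [a] rfl
    simp only [List.cons_append, List.nil_append, hG.wordCount_two, wordCount_singleton,
      ← Finset.mul_sum] at this
    field_simp
    linarith
  have hcod : ∀ a b, G.Adj a b → ∑ v, G.adjInd a v * G.adjInd b v =
      (2 * w * C₂ - 4 * w ^ 2 * (C₁ / (2 * w))) / (2 * w ^ 3) := by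
    intro a b hab
    have := h2 [a, b] rfl
    simp only [List.cons_append, List.nil_append, hG.wordCount_two, hG.wordCount_three,
      adjInd_of_adj hab, one_mul, mul_one] at this
    rw [eq_div_iff (by positivity), ← hdeg b, ← mul_comm C₂, ← this, Finset.mul_sum,
      ← Finset.sum_sub_distrib, Finset.sum_mul]
    exact Finset.sum_congr rfl fun v _ => by ring
  have hd0 : 0 ≤ C₁ / (2 * w) := by
    rw [← hdeg a₀]; exact Finset.sum_nonneg fun v _ => adjInd_nonneg _ _
  have hd : 0 < C₁ / (2 * w) := lt_of_le_of_ne hd0 (by positivity)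
  refine ⟨_, _, hd, ?_, hdeg, hcod⟩
  obtain ⟨b, -, hb⟩ : ∃ b ∈ Finset.univ, G.adjInd a₀ b ≠ 0 :=
    Finset.exists_ne_zero_of_sum_ne_zero (by rw [hdeg a₀]; exact hd.ne')
  have hab : G.Adj a₀ b := by
    by_contra hab
    exact hb (adjInd_of_not_adj hab)
  rw [← hcod a₀ b hab]
  exact Finset.sum_nonneg fun v _ => mul_nonneg (adjInd_nonneg _ _) (adjInd_nonneg _ _)

/-- Consistency for the path `c a b`, with `a` in the middle so that `b` and `c` lie in its
neighbourhood. The choice `c = b` is allowed. -/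
lemma exists_local_codegree (h : G.IsConsistent) (hG : G.HasUniformWeight w) {d t : ℝ}
    (hr : G.IsEdgeRegular d t) :
    ∃ C : ℝ, ∀ a b c, G.Adj a b → G.Adj a c →
      C * (4 * w ^ 2 + 2 * w ^ 3 * G.adjInd b c) = 8 * w ^ 3 * d + 6 * w ^ 4 * t +
        G.adjInd b c * (6 * w ^ 4 * d + 2 * w ^ 5 * t) +
        2 * w ^ 5 * ∑ v, G.adjInd a v * G.adjInd b v * G.adjInd c v := by
  obtain ⟨C, -, hC⟩ := h.exists_sum_wordCount 3
  refine ⟨C, fun a b c hab hac => ?_⟩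
  have hca := hG.adj_symm hac
  have := hC [c, a, b] rfl
  simp only [List.cons_append, List.nil_append, hG.wordCount_four _ hca hab, hG.wordCount_three,
      adjInd_of_adj hab, adjInd_of_adj hca, one_mul] at this
  rw [hG.adjInd_comm b c, ← this]
  have e1 : G.adjInd c b * t = G.adjInd c b * ∑ v, G.adjInd c v * G.adjInd b v := by
    by_cases hcb : G.Adj c b
    · rw [hr.codegree c b hcb]
    · simp [adjInd_of_not_adj hcb]
  have e2 := hr.codegree a b hab
  have e3 := hr.degree b
  trans 8 * w ^ 3 * ∑ v, G.adjInd b v + 6 * w ^ 4 * ∑ v, G.adjInd a v * G.adjInd b v +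
      (6 * w ^ 4 * (G.adjInd c b * ∑ v, G.adjInd b v) +
        2 * w ^ 5 * (G.adjInd c b * ∑ v, G.adjInd c v * G.adjInd b v)) +
        2 * w ^ 5 * ∑ v, G.adjInd a v * G.adjInd b v * G.adjInd c v
  · simp only [Finset.mul_sum, ← Finset.sum_add_distrib]
    exact Finset.sum_congr rfl fun v _ => by ring
  · rw [← e1, e2, e3]
    ring

/-- The identity of `exists_local_codegree` sees `b`, `c` only through their adjacency and the
triple sum, so a non-adjacent pair has the same triple sum as the pair `b`, `b`. -/
lemma sum_local_eq (h : G.IsConsistent) (hG : G.HasUniformWeight w) {d t : ℝ}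
    (hr : G.IsEdgeRegular d t) {a b c : V} (hab : G.Adj a b) (hac : G.Adj a c)
    (hbc : ¬ G.Adj b c) : ∑ v, G.adjInd a v * G.adjInd b v * G.adjInd c v = t := by
  have hw := hG.pos
  obtain ⟨C, hC⟩ := h.exists_local_codegree hG hr
  have h1 := hC a b b hab hab
  have h2 := hC a b c hab hac
  simp only [mul_assoc, adjInd_mul_self, adjInd_of_not_adj hbc,
    adjInd_of_not_adj (hG.not_adj_self b)] at h1 h2
  rw [hr.codegree a b hab] at h1
  rw [h1] at h2
  have h3 : 2 * w ^ 5 * (∑ v, G.adjInd a v * (G.adjInd b v * G.adjInd c v) - t) = 0 := by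
    linarith
  have h4 := (mul_eq_zero.1 h3).resolve_left (by positivity)
  simp only [mul_assoc]
  linarith

/-- Within a neighbourhood, non-adjacent vertices have the same neighbours. -/
lemma adj_of_local (h : G.IsConsistent) (hG : G.HasUniformWeight w) {d t : ℝ}
    (hr : G.IsEdgeRegular d t) {a b c v : V} (hab : G.Adj a b) (hac : G.Adj a c)
    (hbc : ¬ G.Adj b c) (hav : G.Adj a v) (hbv : G.Adj b v) : G.Adj c v := by
  have h1 := h.sum_local_eq hG hr hab hac hbc
  rw [← hr.codegree a b hab, ← sub_eq_zero, ← Finset.sum_sub_distrib] at h1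
  -- The sum for `b`, `c` is termwise at most the codegree of `a`, `b`; the totals agree, so every
  -- term does.
  have h2 := (Finset.sum_eq_zero_iff_of_nonpos fun v _ => ?_).1 h1 v (Finset.mem_univ v)
  · by_contra hcv
    simp [adjInd_of_not_adj hcv, adjInd_of_adj hav, adjInd_of_adj hbv] at h2
  · have := mul_nonneg (adjInd_nonneg (G := G) a v) (adjInd_nonneg (G := G) b v)
    nlinarith [adjInd_le_one (G := G) c v]

/-- The local identity is summed over `b` in the neighbourhood of `a`, with `c` fixed there, and
compared with its case `b = c`. Eliminating `C` leaves a positive multiple of `1 - w`. -/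
lemma weight_eq_one (h : G.IsConsistent) (hG : G.HasUniformWeight w) {d t : ℝ}
    (hr : G.IsEdgeRegular d t) (hd : 0 < d) (ht : 0 < t) : w = 1 := by
  have hw := hG.pos
  obtain ⟨a⟩ := h.nonempty
  obtain ⟨C, hC⟩ := h.exists_local_codegree hG hr
  obtain ⟨c, -, hc⟩ : ∃ b ∈ Finset.univ, G.adjInd a b ≠ 0 :=
    Finset.exists_ne_zero_of_sum_ne_zero (by rw [hr.degree a]; exact hd.ne')
  have hac : G.Adj a c := by
    by_contra hab
    exact hc (adjInd_of_not_adj hab)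
  have h0 := hC a c c hac hac
  simp only [mul_assoc, adjInd_mul_self, adjInd_of_not_adj (hG.not_adj_self c)] at h0
  rw [hr.codegree a c hac] at h0
  have hsum : ∀ b, G.adjInd a b * (C * (4 * w ^ 2 + 2 * w ^ 3 * G.adjInd b c)) =
      G.adjInd a b * (8 * w ^ 3 * d + 6 * w ^ 4 * t +
        G.adjInd b c * (6 * w ^ 4 * d + 2 * w ^ 5 * t) +
        2 * w ^ 5 * ∑ v, G.adjInd a v * G.adjInd b v * G.adjInd c v) := by
    intro b
    by_cases hab : G.Adj a b
    · rw [hC a b c hab hac]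
    · simp [adjInd_of_not_adj hab]
  have hcod : ∑ b, G.adjInd a b * G.adjInd b c = t := by
    rw [← hr.codegree a c hac]
    exact Finset.sum_congr rfl fun v _ => by rw [hG.adjInd_comm v c]
  -- Exchange the sums: each `v` adjacent to `a` and `c` has codegree `t` with `a`, and there are
  -- `t` such `v`.
  have hQ : ∑ b, G.adjInd a b * ∑ v, G.adjInd a v * G.adjInd b v * G.adjInd c v = t * t := by
    simp only [Finset.mul_sum]
    rw [Finset.sum_comm]
    rw [← hr.codegree a c hac, Finset.sum_mul]
    refine Finset.sum_congr rfl fun v _ => ?_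
    by_cases hav : G.Adj a v
    · rw [hr.codegree a c hac, ← hr.codegree a v hav, Finset.mul_sum]
      exact Finset.sum_congr rfl fun b _ => by rw [hG.adjInd_comm v b]; ring
    · simp [adjInd_of_not_adj hav]
  have h1 : C * (4 * w ^ 2 * d + 2 * w ^ 3 * t) = (8 * w ^ 3 * d + 6 * w ^ 4 * t) * d +
      t * (6 * w ^ 4 * d + 2 * w ^ 5 * t) + 2 * w ^ 5 * (t * t) := by
    have h2 := Finset.sum_congr rfl fun b (_ : b ∈ Finset.univ) => hsum b
    have e1 : ∑ b, G.adjInd a b * (C * (4 * w ^ 2 + 2 * w ^ 3 * G.adjInd b c)) =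
        C * (4 * w ^ 2 * ∑ b, G.adjInd a b + 2 * w ^ 3 * ∑ b, G.adjInd a b * G.adjInd b c) := by
      simp only [Finset.mul_sum, ← Finset.sum_add_distrib]
      exact Finset.sum_congr rfl fun b _ => by ring
    have e2 : ∑ b, G.adjInd a b * (8 * w ^ 3 * d + 6 * w ^ 4 * t +
        G.adjInd b c * (6 * w ^ 4 * d + 2 * w ^ 5 * t) +
        2 * w ^ 5 * ∑ v, G.adjInd a v * G.adjInd b v * G.adjInd c v) =
        (∑ b, G.adjInd a b) * (8 * w ^ 3 * d + 6 * w ^ 4 * t) +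
        (∑ b, G.adjInd a b * G.adjInd b c) * (6 * w ^ 4 * d + 2 * w ^ 5 * t) +
        2 * w ^ 5 * ∑ b, G.adjInd a b * ∑ v, G.adjInd a v * G.adjInd b v * G.adjInd c v := by
      rw [Finset.sum_mul, Finset.sum_mul, Finset.mul_sum, ← Finset.sum_add_distrib,
        ← Finset.sum_add_distrib]
      exact Finset.sum_congr rfl fun b _ => by ring
    rw [e1, e2, hcod, hr.degree a, hQ] at h2
    rw [h2]
    ring
  have h2 : t * w ^ 4 * (2 * d + w * t) * (1 - w) = 0 := by
    linear_combination -(h1 - d * h0 - w * t / 2 * h0)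
  have h3 := (mul_eq_zero.1 h2).resolve_left (by positivity)
  linarith

end IsConsistent

end WeightedGraph

/-! ### Triangle-free graphs, and twins -/

namespace WeightedGraph

variable {V : Type*} {G : WeightedGraph V} {w : ℝ}

section TriangleFree

/-- Deleting an interior letter brings two of its neighbours together, and without triangles they
are not adjacent. The prefix `x` is there for the induction. -/
lemma delSum_interior_eq_zero (hT : ∀ a b c, G.Adj a b → G.Adj b c → ¬ G.Adj a c)
    (x m : List V) (p b : V) (h : (x ++ p :: (m ++ [b])).IsChain G.Adj) :
    delSum (fun m' => G.wordCount (x ++ p :: (m' ++ [b]))) m = 0 := by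
  induction m generalizing x p with
  | nil => rfl
  | cons v m ih =>
    have h1 : G.wordCount (x ++ p :: (m ++ [b])) = 0 := by
      refine G.wordCount_eq_zero fun h' => ?_
      obtain ⟨q, r, hqr⟩ := List.exists_cons_of_ne_nil (l := m ++ [b]) (by simp)
      rw [List.cons_append, hqr] at h
      rw [hqr, List.isChain_append_cons_cons] at h'
      rw [List.isChain_append_cons_cons, List.isChain_cons_cons] at h
      exact hT p v q h.2.1 h.2.2.1 h'.2.1
    have h2 := ih (x ++ [p]) v (by simpa using h)
    simp only [List.append_assoc, List.cons_append, List.nil_append] at h2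
    rw [delSum_cons, h1, zero_add]
    exact h2

/-- Only the two end deletions survive, each with weight `w`. -/
lemma HasUniformWeight.wordCount_of_triangleFree (hG : G.HasUniformWeight w)
    (hT : ∀ a b c, G.Adj a b → G.Adj b c → ¬ G.Adj a c) (a : V) (l : List V)
    (h : (a :: l).IsChain G.Adj) : G.wordCount (a :: l) = (2 * w) ^ l.length := by
  induction hn : l.length generalizing a l with
  | zero =>
    obtain rfl := List.length_eq_zero_iff.1 hn
    simp [wordCount_singleton]
  | succ n ih =>
    obtain ⟨m, b, rfl⟩ := (List.eq_nil_or_concat l).resolve_left (by rintro rfl; simp at hn)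
    rw [List.concat_eq_append] at *
    have h0 := delSum_interior_eq_zero hT [] m a b h
    simp only [List.nil_append] at h0
    have hlen : m.length = n := by simpa using hn
    obtain ⟨q, r, hqr⟩ := List.exists_cons_of_ne_nil (l := m ++ [b]) (by simp)
    rw [hG.wordCount_cons_append a b m h, h0, ih a m (h.left_of_append (l₁ := a :: m)) hlen, hqr,
      ih q r (hqr ▸ h.tail)]
    · ring
    · have := congrArg List.length hqr
      simp at this
      omega

variable [Fintype V]

open Classical in
lemma HasUniformWeight.gapSum_of_triangleFree (hG : G.HasUniformWeight w)
    (hT : ∀ a b c, G.Adj a b → G.Adj b c → ¬ G.Adj a c) (k : ℕ) (a c : V) :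
    G.gapSum k [a] [c] = (2 * w) ^ (k + 1) * (Matrix.of G.adjInd ^ (k + 1)) a c := by
  induction k generalizing a with
  | zero => simp [gapSum_zero, hG.wordCount_two]
  | succ k ih =>
    rw [gapSum_succ, pow_succ' (Matrix.of _), Matrix.mul_apply, Finset.mul_sum]
    refine Finset.sum_congr rfl fun v _ => ?_
    have : G.gapSum k ([a] ++ [v]) [c] = 2 * w * G.adjInd a v * G.gapSum k [v] [c] := by
      rw [gapSum, gapSum, Finset.mul_sum]
      refine Finset.sum_congr rfl fun z _ => ?_
      simp only [List.cons_append, List.nil_append]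
      generalize List.ofFn z ++ [c] = l
      by_cases hl : (v :: l).IsChain G.Adj
      · by_cases hav : G.Adj a v
        · rw [hG.wordCount_of_triangleFree hT v l hl, hG.wordCount_of_triangleFree hT a (v :: l)
            (List.isChain_cons_cons.2 ⟨hav, hl⟩), adjInd_of_adj hav, List.length_cons, pow_succ]
          ring
        · rw [G.wordCount_eq_zero fun h => hav (List.isChain_cons_cons.1 h).1,
            adjInd_of_not_adj hav]
          ring
      · rw [G.wordCount_eq_zero hl, G.wordCount_eq_zero fun h => hl (List.isChain_cons_cons.1 h).2,
          mul_zero]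
    rw [this, ih, Matrix.of_apply]
    ring

end TriangleFree

variable [Fintype V]

lemma IsEdgeRegular.exists_adj {d t : ℝ} (hr : G.IsEdgeRegular d t) (hd : 0 < d) (a : V) :
    ∃ b, G.Adj a b := by
  obtain ⟨b, -, hb⟩ : ∃ b ∈ Finset.univ, G.adjInd a b ≠ 0 :=
    Finset.exists_ne_zero_of_sum_ne_zero (by rw [hr.degree a]; exact hd.ne')
  refine ⟨b, ?_⟩
  by_contra hab
  exact hb (adjInd_of_not_adj hab)

lemma IsEdgeRegular.exists_adj_adj {d t : ℝ} (hr : G.IsEdgeRegular d t) (ht : 0 < t) {a b : V}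
    (hab : G.Adj a b) : ∃ c, G.Adj a c ∧ G.Adj b c := by
  obtain ⟨c, -, hc⟩ : ∃ c ∈ Finset.univ, G.adjInd a c * G.adjInd b c ≠ 0 :=
    Finset.exists_ne_zero_of_sum_ne_zero (by rw [hr.codegree a b hab]; exact ht.ne')
  refine ⟨c, ?_⟩
  by_contra h
  rcases not_and_or.1 h with h | h <;> simp [adjInd_of_not_adj h] at hc

lemma IsEdgeRegular.not_adj_of_codegree_zero {d : ℝ} (hr : G.IsEdgeRegular d 0)
    (a b c : V) (hab : G.Adj a b) (hbc : G.Adj b c) :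
    ¬ G.Adj a c := by
  intro hac
  have := (Finset.sum_eq_zero_iff_of_nonneg fun v _ =>
    mul_nonneg (adjInd_nonneg _ _) (adjInd_nonneg _ _)).1 (hr.codegree a b hab) c
      (Finset.mem_univ c)
  simp [adjInd_of_adj hac, adjInd_of_adj hbc] at this

namespace IsConsistent

/-- Non-adjacent vertices with a common neighbour have the same neighbours. -/
lemma adj_of_common_neighbor (h : G.IsConsistent) (hG : G.HasUniformWeight w) {d t : ℝ}
    (hr : G.IsEdgeRegular d t) (ht : 0 < t) {a b b' u : V} (hab : G.Adj a b) (hab' : G.Adj a b')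
    (hbb' : ¬ G.Adj b b') (hbu : G.Adj b u) : G.Adj b' u := by
  by_cases hau : G.Adj a u
  · exact h.adj_of_local hG hr hab hab' hbb' hau hbu
  -- Pass through a common neighbour `c` of `a` and `b`: the neighbourhood of `b` gives `u ~ c`,
  -- that of `a` gives `b' ~ c`, and that of `c` then gives `b' ~ u`.
  · obtain ⟨c, hac, hbc⟩ := hr.exists_adj_adj ht hab
    have huc : G.Adj u c := h.adj_of_local hG hr (hG.adj_symm hab) hbu hau hbc hac
    have hb'c : G.Adj b' c := h.adj_of_local hG hr hab hab' hbb' hac hbc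
    exact h.adj_of_local hG hr (hG.adj_symm hbc) (hG.adj_symm hb'c) hbb' (hG.adj_symm huc) hbu

/-- "Adjacent or twins" propagates backwards along a walk by `adj_of_common_neighbor`. -/
lemma adj_or_twins_of_isChain (h : G.IsConsistent) (hG : G.HasUniformWeight w) {d t : ℝ}
    (hr : G.IsEdgeRegular d t) (ht : 0 < t) (a v : V) (l : List V)
    (hl : (a :: l).IsChain G.Adj) (hv : v ∈ a :: l) :
    G.Adj a v ∨ ∀ u, G.Adj a u ↔ G.Adj v u := by
  induction l generalizing a with
  | nil =>
    obtain rfl : v = a := by simpa using hv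
    exact Or.inr fun _ => Iff.rfl
  | cons b l ih =>
    rcases List.mem_cons.1 hv with rfl | hv
    · exact Or.inr fun _ => Iff.rfl
    · obtain ⟨hab, hl⟩ := List.isChain_cons_cons.1 hl
      rcases ih b hl hv with hbv | hbv
      · by_cases hav : G.Adj a v
        · exact Or.inl hav
        · exact Or.inr fun u => ⟨
            h.adj_of_common_neighbor hG hr ht (hG.adj_symm hab) hbv hav,
            h.adj_of_common_neighbor hG hr ht hbv (hG.adj_symm hab)
              fun hva => hav (hG.adj_symm hva)⟩
      · exact Or.inl (hG.adj_symm ((hbv a).1 (hG.adj_symm hab)))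

/-- If the insertion algorithm is consistent and the symbols at distance `k + 1` are independent,
then the graph is complete multipartite with parts of equal size, and the weight is one. -/
lemma exists_isEquipartite (h : G.IsConsistent) (hG : G.HasUniformWeight w) {k : ℕ} {K : ℝ}
    (hK : K ≠ 0) (hk : ∀ a c, G.gapSum k [a] [c] = K) :
    w = 1 ∧ ∃ s : ℕ, G.IsEquipartite s ∧ ∃ a c, G.Adj a c := by
  classical
  obtain ⟨d, t, hd, ht, hr⟩ := h.exists_isEdgeRegular hG
  have hne := h.nonempty
  rcases ht.eq_or_lt with rfl | ht
  · exfalso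
    have hT := hr.not_adj_of_codegree_zero
    have hw := hG.pos
    refine not_matrix_pow_eq_const (A := Matrix.of G.adjInd) (d := d) hG.adjInd_comm
      (fun a => adjInd_of_not_adj (hG.not_adj_self a)) hr.degree hd.ne' (Nat.le_add_left 1 k)
      ⟨K / (2 * w) ^ (k + 1), fun a c => ?_⟩
    rw [← hk a c, hG.gapSum_of_triangleFree hT]
    field_simp
  · obtain rfl := h.weight_eq_one hG hr hd ht
    refine ⟨rfl, ?_⟩
    obtain ⟨a₀⟩ := hne
    obtain ⟨c₀, hc₀⟩ := hr.exists_adj hd a₀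
    refine ⟨Nat.card {b // ¬ G.Adj a₀ b}, ⟨hG, fun {a b} hab => ?_, fun a => ?_⟩, a₀, c₀, hc₀⟩
    -- As `K ≠ 0`, some word from `a` to `b` has a nonzero count, hence is a walk joining them.
    · obtain ⟨z, -, hz⟩ : ∃ z ∈ Finset.univ,
          G.wordCount ([a] ++ List.ofFn (z : Fin k → V) ++ [b]) ≠ 0 :=
        Finset.exists_ne_zero_of_sum_ne_zero (by rw [← gapSum, hk a b]; exact hK)
      have hc : (a :: (List.ofFn z ++ [b])).IsChain G.Adj := by
        by_contra hc
        exact hz (G.wordCount_eq_zero hc)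
      exact (h.adj_or_twins_of_isChain hG hr ht a b _ hc (by simp)).resolve_left hab
    · have key : ∀ a, (Nat.card {b // ¬ G.Adj a b} : ℝ) = Fintype.card V - d := by
        intro a
        rw [← hr.degree a, Nat.card_eq_fintype_card, Fintype.card_subtype, Finset.card_filter,
          eq_sub_iff_add_eq]
        push_cast
        rw [← Finset.sum_add_distrib, Finset.sum_congr rfl fun v _ => show _ = (1 : ℝ) by
          by_cases hv : G.Adj a v
          · simp [hv, adjInd_of_adj hv]
          · simp [hv, adjInd_of_not_adj hv]]
        simp
      exact_mod_cast (key a).trans (key a₀).symm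

end IsConsistent

end WeightedGraph

/-! ### The law on bi-infinite words -/

namespace WeightedGraph

variable {V : Type*} [Fintype V] {G : WeightedGraph V}

lemma buildingCount_nonneg {V : Type*} {G : WeightedGraph V} {n : ℕ} (x : Fin n → V) :
    0 ≤ G.buildingCount x := by
  refine Finset.sum_nonneg fun σ _ => mul_nonneg
    (Finset.prod_nonneg fun t _ => ?_) (Finset.prod_nonneg fun t _ => ?_)
  · rw [leftFactor]; split_ifs
    · exact G.weight_nonneg _ _
    · exact zero_le_one
  · rw [rightFactor]; split_ifs
    · exact G.weight_nonneg _ _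
    · exact zero_le_one

lemma insertionProb_nonneg {n : ℕ} (x : Fin n → V) : 0 ≤ G.insertionProb x :=
  div_nonneg (buildingCount_nonneg x) (Finset.sum_nonneg fun y _ => buildingCount_nonneg y)

/-- The probability that the insertion algorithm assigns to a word given as a list. -/
noncomputable def wordProb (G : WeightedGraph V) (l : List V) : ℝ :=
  G.wordCount l / G.total l.length

lemma wordProb_ofFn {n : ℕ} (x : Fin n → V) : G.wordProb (List.ofFn x) = G.insertionProb x := by
  rw [wordProb, List.length_ofFn, insertionProb_eq]

namespace IsConsistent

lemma sum_wordProb_append_singleton (h : G.IsConsistent) (l : List V) :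
    ∑ v, G.wordProb (l ++ [v]) = G.wordProb l := by
  have := (h _ l.get).1
  simp only [← wordProb_ofFn, ofFn_snoc, List.ofFn_get] at this
  exact this.symm

lemma sum_wordProb_cons (h : G.IsConsistent) (l : List V) :
    ∑ v, G.wordProb (v :: l) = G.wordProb l := by
  have := (h _ l.get).2
  simp only [← wordProb_ofFn, List.ofFn_cons, List.ofFn_get] at this
  exact this.symm

lemma sum_wordProb_append (h : G.IsConsistent) (b : ℕ) (l : List V) :
    ∑ z : Fin b → V, G.wordProb (l ++ List.ofFn z) = G.wordProb l := by
  induction b generalizing l with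
  | zero => simp
  | succ b ih =>
    rw [sum_ofFn_succ b fun z => G.wordProb (l ++ z), ← h.sum_wordProb_append_singleton l]
    refine Finset.sum_congr rfl fun v _ => ?_
    rw [← ih (l ++ [v])]
    simp

lemma sum_wordProb_append_left (h : G.IsConsistent) (a : ℕ) (l : List V) :
    ∑ z : Fin a → V, G.wordProb (List.ofFn z ++ l) = G.wordProb l := by
  induction a with
  | zero => simp
  | succ a ih =>
    rw [sum_ofFn_succ a fun z => G.wordProb (z ++ l), Finset.sum_comm, ← ih]
    exact Finset.sum_congr rfl fun z _ => h.sum_wordProb_cons _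

open Classical in
/-- The distribution of a window inside a random word of the insertion algorithm. -/
lemma sum_insertionProb_window (h : G.IsConsistent) (v₀ : V) {N a m : ℕ} (hN : a + m ≤ N)
    (y : Fin m → V) :
    ∑ x : Fin N → V, (if ∀ j : Fin m, (List.ofFn x).getD (a + j) v₀ = y j then
      G.insertionProb x else 0) = G.insertionProb y := by
  obtain ⟨b, rfl⟩ := Nat.exists_eq_add_of_le hN
  simp only [← wordProb_ofFn]
  refine (sum_ofFn_add (a + m) b fun l => if ∀ j : Fin m, l.getD (a + j) v₀ = y j then
    G.wordProb l else 0).trans ?_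
  refine (sum_ofFn_add a m fun l => ∑ v : Fin b → V,
    if ∀ j : Fin m, (l ++ List.ofFn v).getD (a + j) v₀ = y j then
      G.wordProb (l ++ List.ofFn v) else 0).trans ?_
  rw [← h.sum_wordProb_append_left a]
  refine Finset.sum_congr rfl fun u _ => ?_
  rw [Finset.sum_eq_single y]
  · rw [← h.sum_wordProb_append b]
    refine Finset.sum_congr rfl fun v _ => if_pos fun j => ?_
    rw [List.append_assoc, List.getD_append_right _ _ _ _ (by simp), List.length_ofFn,
      Nat.add_sub_cancel_left, List.getD_append _ _ _ _ (by simp)]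
    simp
  · intro z _ hz
    refine Finset.sum_eq_zero fun v _ => if_neg fun hj => hz (funext fun j => ?_)
    rw [← hj j, List.append_assoc, List.getD_append_right _ _ _ _ (by simp), List.length_ofFn,
      Nat.add_sub_cancel_left, List.getD_append _ _ _ _ (by simp)]
    simp
  · simp

end IsConsistent

variable [MeasurableSpace V]

/-- The word of length `n` read from position `i` on. -/
def window {V : Type*} (i : ℤ) (n : ℕ) (ξ : ℤ → V) : Fin n → V := fun j => ξ (i + j)

lemma measurable_window {V : Type*} [MeasurableSpace V] (i : ℤ) (n : ℕ) :
    Measurable (window (V := V) i n) :=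
  measurable_pi_lambda _ fun _ => measurable_pi_apply _

lemma window_preimage_singleton {V : Type*} (i : ℤ) {n : ℕ} (x : Fin n → V) :
    window i n ⁻¹' {x} = {ξ | ∀ j : Fin n, ξ (i + j) = x j} := by
  ext ξ
  simp [window, funext_iff]

lemma window_append {V : Type*} (i : ℤ) {m n : ℕ} (x : Fin m → V) (y : Fin n → V) :
    window i (m + n) ⁻¹' {Fin.append x y} = window i m ⁻¹' {x} ∩ window (i + m) n ⁻¹' {y} := by
  ext ξ
  simp only [window_preimage_singleton, Set.mem_ofPred_eq, Set.mem_inter_iff]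
  constructor
  · refine fun h => ⟨fun j => by simpa using h (j.castAdd n), fun j => ?_⟩
    simpa [add_assoc] using h (j.natAdd m)
  · rintro ⟨h1, h2⟩ j
    refine Fin.addCases (fun j => ?_) (fun j => ?_) j
    · simpa using h1 j
    · simpa [add_assoc] using h2 j

/-- The insertion process of a consistent insertion algorithm exists. -/
lemma IsConsistent.exists_isInsertionLaw [DiscreteMeasurableSpace V] (h : G.IsConsistent) :
    ∃ μ : Measure (ℤ → V), G.IsInsertionLaw μ := by
  classical
  obtain ⟨v₀⟩ := h.nonempty
  let _ : TopologicalSpace V := ⊥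
  have : DiscreteTopology V := ⟨rfl⟩
  -- A word of length `2n` is placed on the positions from `-n` to `n - 1`; what stands outside is
  -- irrelevant to windows inside.
  let f : (n : ℕ) → (Fin (2 * n) → V) → ℤ → V := fun n x i => (List.ofFn x).getD (i + n).toNat v₀
  let ν : ℕ → Measure (ℤ → V) := fun n =>
    ∑ x : Fin (2 * n) → V, ENNReal.ofReal (G.insertionProb x) • Measure.dirac (f n x)
  have hν : ∀ n, IsProbabilityMeasure (ν n) := by
    intro n
    constructor
    simp only [ν, Measure.finsetSum_apply, Measure.smul_apply, measure_univ, smul_eq_mul, mul_one]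
    rw [← ENNReal.ofReal_sum_of_nonneg fun x _ => insertionProb_nonneg x, h.sum_insertionProb]
    simp
  have hclopen : ∀ (i : ℤ) (m : ℕ) (y : Fin m → V), IsClopen (window i m ⁻¹' {y}) := by
    intro i m y
    have hc : Continuous (window (V := V) i m) := continuous_pi fun j => continuous_apply _
    exact (isClopen_discrete {y}).preimage hc
  have hνw : ∀ (i : ℤ) (m n : ℕ) (y : Fin m → V), 0 ≤ i + n → i + m ≤ n →
      ν n (window i m ⁻¹' {y}) = ENNReal.ofReal (G.insertionProb y) := by
    intro i m n y h1 h2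
    obtain ⟨a, ha⟩ := Int.eq_ofNat_of_zero_le h1
    rw [← h.sum_insertionProb_window v₀ (N := 2 * n) (a := a) (by omega) y,
      ENNReal.ofReal_sum_of_nonneg fun x _ => by
        split_ifs
        · exact insertionProb_nonneg x
        · exact le_rfl]
    simp only [ν, Measure.finsetSum_apply, Measure.smul_apply, smul_eq_mul]
    refine Finset.sum_congr rfl fun x _ => ?_
    rw [Measure.dirac_apply' _ (measurable_window _ _ (measurableSet_singleton _))]
    have : f n x ∈ window i m ⁻¹' {y} ↔ ∀ j : Fin m, (List.ofFn x).getD (a + j) v₀ = y j := by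
      rw [window_preimage_singleton, Set.mem_ofPred_eq]
      refine forall_congr' fun j => ?_
      simp only [f]
      rw [show (i + (j : ℤ) + n).toNat = a + j by omega]
    by_cases hx : f n x ∈ window i m ⁻¹' {y}
    · rw [Set.indicator_of_mem hx, if_pos (this.1 hx)]
      simp
    · rw [Set.indicator_of_notMem hx, if_neg fun h' => hx (this.2 h')]
      simp
  -- Since `V` is finite, probability measures on `ℤ → V` form a compact space, so an ultrafilter
  -- limit exists. Window events are clopen, so their probabilities, eventually constant, pass to
  -- the limit.
  let U : Ultrafilter ℕ := Filter.hyperfilter ℕ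
  let νP : ℕ → ProbabilityMeasure (ℤ → V) := fun n => ⟨ν n, hν n⟩
  obtain ⟨μ, hμ⟩ : ∃ μ, Filter.Tendsto νP U (nhds μ) :=
    ⟨_, (U.map νP).le_nhds_lim⟩
  refine ⟨μ, inferInstance, fun i m y => ?_⟩
  have ht := ProbabilityMeasure.tendsto_measure_of_null_frontier_of_tendsto' hμ
    (E := window (i + 1) m ⁻¹' {y}) (by rw [(hclopen (i + 1) m y).frontier_eq]; simp)
  have he : ∀ᶠ n in (U : Filter ℕ), (νP n : Measure (ℤ → V)) (window (i + 1) m ⁻¹' {y}) =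
      ENNReal.ofReal (G.insertionProb y) := by
    refine Filter.Eventually.filter_mono (Nat.hyperfilter_le_atTop) ?_
    filter_upwards [Filter.eventually_ge_atTop ((i + 1).natAbs + m)] with n hn
    exact hνw _ _ _ _ (by omega) (by omega)
  rw [← window_preimage_singleton]
  exact tendsto_nhds_unique ht (tendsto_const_nhds.congr' (he.mono fun n hn => hn.symm))

namespace IsInsertionLaw

variable {μ : Measure (ℤ → V)}

lemma measure_window (hμ : G.IsInsertionLaw μ) (i : ℤ) {n : ℕ} (x : Fin n → V) :
    μ (window i n ⁻¹' {x}) = ENNReal.ofReal (G.insertionProb x) := by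
  rw [window_preimage_singleton, ← hμ.marginal (i - 1) n x]
  simp

variable [DiscreteMeasurableSpace V]

lemma map_window_eq (hμ : G.IsInsertionLaw μ) (i j : ℤ) (n : ℕ) :
    μ.map (window i n) = μ.map (window j n) := by
  refine Measure.ext_of_singleton fun x => ?_
  rw [Measure.map_apply (measurable_window _ _) (measurableSet_singleton _),
    Measure.map_apply (measurable_window _ _) (measurableSet_singleton _),
    hμ.measure_window, hμ.measure_window]

/-- The joint law of two windows separated by a gap. -/
lemma measure_window_inter (hμ : G.IsInsertionLaw μ) (i : ℤ) {m n : ℕ} (k : ℕ) (x : Fin m → V)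
    (y : Fin n → V) :
    μ (window i m ⁻¹' {x} ∩ window (i + m + k) n ⁻¹' {y}) =
      ENNReal.ofReal (G.gapSum k (List.ofFn x) (List.ofFn y) / G.total (m + k + n)) := by
  classical
  have key : ∀ z : Fin k → V,
      window (i + m) k ⁻¹' {z} ∩ (window i m ⁻¹' {x} ∩ window (i + m + k) n ⁻¹' {y}) =
        window i (m + k + n) ⁻¹' {Fin.append (Fin.append x z) y} := by
    intro z
    rw [window_append, window_append, Nat.cast_add, ← add_assoc]
    ext ξ
    simp only [Set.mem_inter_iff]
    tauto
  have hmeas : ∀ z : Fin k → V, MeasurableSet (window (V := V) (i + m) k ⁻¹' {z}) := fun z =>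
    measurable_window _ _ (measurableSet_singleton _)
  have h1 := sum_measure_preimage_singleton (μ := μ.restrict
    (window i m ⁻¹' {x} ∩ window (i + m + k) n ⁻¹' {y})) Finset.univ
    (f := window (V := V) (i + m) k) fun z _ => hmeas z
  rw [Finset.coe_univ, Set.preimage_univ, Measure.restrict_apply_univ] at h1
  rw [← h1, gapSum, Finset.sum_div, ENNReal.ofReal_sum_of_nonneg fun z _ => ?_]
  · refine Finset.sum_congr rfl fun z _ => ?_
    rw [Measure.restrict_apply (hmeas z), key, hμ.measure_window, insertionProb_eq,
      List.ofFn_fin_append, List.ofFn_fin_append]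
  · rw [← List.ofFn_fin_append, ← List.ofFn_fin_append, ← insertionProb_eq]
    exact insertionProb_nonneg _

/-- In a `k`-dependent insertion process the symbols at distance `k + 1` are independent. -/
lemma exists_gapSum_eq (hμ : G.IsInsertionLaw μ) (hG : G.IsConsistent) {k : ℕ}
    (hk : IsStationaryKDependent k μ) : ∃ K : ℝ, K ≠ 0 ∧ ∀ a c, G.gapSum k [a] [c] = K := by
  have hne := hG.nonempty
  have hN : (Fintype.card V : ℝ) ≠ 0 := by simp
  have ht := hG.total_ne_zero (1 + k + 1)
  refine ⟨G.total (1 + k + 1) / (Fintype.card V) ^ 2, div_ne_zero ht (pow_ne_zero _ hN),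
    fun a c => ?_⟩
  -- Between the positions `-1` and `k` there are exactly `k` symbols.
  have h1 := hμ.measure_window_inter (-1) k (fun _ : Fin 1 => a) (fun _ : Fin 1 => c)
  have h2 := hk.indep.measure_inter_preimage_eq_mul
    ((fun g => g ⟨-1, by simp⟩) ⁻¹' {a}) ((fun g => g ⟨k, by simp⟩) ⁻¹' {c})
    (measurable_pi_apply _ (measurableSet_singleton a))
    (measurable_pi_apply _ (measurableSet_singleton c))
  have e1 : (fun (ξ : ℤ → V) (i : Set.Iio (0 : ℤ)) => ξ i) ⁻¹'
      ((fun g => g ⟨-1, by simp⟩) ⁻¹' {a}) =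
      window (-1) 1 ⁻¹' {fun _ => a} := by
    ext ξ
    simp [window_preimage_singleton]
  have e2 : (fun (ξ : ℤ → V) (i : Set.Ici (k : ℤ)) => ξ i) ⁻¹' ((fun g => g ⟨k, by simp⟩) ⁻¹' {c}) =
      window (-1 + (1 : ℕ) + k) 1 ⁻¹' {fun _ => c} := by
    ext ξ
    simp [window_preimage_singleton]
  rw [e1, e2, h1, hμ.measure_window, hμ.measure_window,
    ← ENNReal.ofReal_mul (insertionProb_nonneg _)] at h2
  have h0 : 0 ≤ G.gapSum k [a] [c] / G.total (1 + k + 1) := by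
    refine div_nonneg (Finset.sum_nonneg fun z _ => buildingCount_nonneg _)
      (Finset.sum_nonneg fun z _ => buildingCount_nonneg _)
  simp only [List.ofFn_succ, List.ofFn_zero] at h2
  rw [ENNReal.ofReal_eq_ofReal_iff h0
    (mul_nonneg (insertionProb_nonneg _) (insertionProb_nonneg _)), insertionProb_eq,
    insertionProb_eq, total_one] at h2
  simp only [List.ofFn_succ, List.ofFn_zero, wordCount_singleton] at h2
  field_simp at h2 ⊢
  linarith

/-- An insertion law is stationary. -/
lemma map_shift_eq (hμ : G.IsInsertionLaw μ) :
    μ.map (fun (ξ : ℤ → V) (i : ℤ) => ξ (i + 1)) = μ := by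
  have := hμ.isProbabilityMeasure
  have hs : Measurable fun (ξ : ℤ → V) (i : ℤ) => ξ (i + 1) :=
    measurable_pi_lambda _ fun _ => measurable_pi_apply _
  have h1 := (map_eq_iff_forall_finset_map_restrict_eq (P := μ)
    (X := fun (i : ℤ) (ξ : ℤ → V) => ξ (i + 1)) (Y := fun (i : ℤ) (ξ : ℤ → V) => ξ i)
    hs.aemeasurable measurable_id.aemeasurable).2 ?_
  · rw [h1]
    exact Measure.map_id
  · intro I
    obtain ⟨n, hn⟩ : ∃ n : ℕ, ∀ i ∈ I, i.natAbs < n := by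
      refine ⟨I.sup Int.natAbs + 1, fun i hi => Nat.lt_succ_of_le (Finset.le_sup hi)⟩
    let g : (Fin (2 * n) → V) → I → V := fun x i =>
      x ⟨(i.1 + n).toNat, by have := hn i i.2; omega⟩
    have hg : Measurable g := measurable_of_countable g
    have e1 : (fun ξ : ℤ → V => I.restrict fun i => ξ (i + 1)) = g ∘ window (-n + 1) (2 * n) := by
      funext ξ i
      have := hn i i.2
      simp only [Function.comp, g, window, Finset.restrict]
      congr 1
      omega
    have e2 : (fun ξ : ℤ → V => I.restrict fun i => ξ i) = g ∘ window (-n) (2 * n) := by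
      funext ξ i
      have := hn i i.2
      simp only [Function.comp, g, window, Finset.restrict]
      congr 1
      omega
    rw [e1, e2, ← Measure.map_map hg (measurable_window _ _),
      ← Measure.map_map hg (measurable_window _ _), hμ.map_window_eq (-n + 1) (-n)]

/-- An insertion law is `k`-dependent if windows separated by a gap of some length `k₀ ≤ k`
decouple. -/
lemma isStationaryKDependent (hμ : G.IsInsertionLaw μ) {k₀ k : ℕ} (hk : k₀ ≤ k)
    (h : ∀ (m n : ℕ) (x : Fin m → V) (y : Fin n → V),
      G.gapSum k₀ (List.ofFn x) (List.ofFn y) / G.total (m + k₀ + n) =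
        G.insertionProb x * G.insertionProb y) : IsStationaryKDependent k μ := by
  have := hμ.isProbabilityMeasure
  refine ⟨hμ.map_shift_eq, ?_⟩
  -- It is enough to treat finite windows: `[-m, 0)` and `[k₀, k₀ + n)` are separated by a gap of
  -- length `k₀`.
  have hw : ∀ m n : ℕ, IndepFun (window (V := V) (-m) m) (window (V := V) k₀ n) μ := by
    intro m n
    rw [indepFun_iff_map_prod_eq_prod_map_map (measurable_window _ _).aemeasurable
      (measurable_window _ _).aemeasurable]
    refine Measure.ext_of_singleton fun p => ?_
    obtain ⟨x, y⟩ := p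
    rw [← Set.singleton_prod_singleton, Measure.prod_prod,
      Measure.map_apply ((measurable_window _ _).prodMk (measurable_window _ _))
        ((measurableSet_singleton _).prod (measurableSet_singleton _)),
      Measure.map_apply (measurable_window _ _) (measurableSet_singleton _),
      Measure.map_apply (measurable_window _ _) (measurableSet_singleton _), hμ.measure_window,
      hμ.measure_window, ← ENNReal.ofReal_mul (insertionProb_nonneg _), ← h m n x y,
      ← hμ.measure_window_inter (-m), Set.mk_preimage_prod]
    simp
  refine IndepFun.process_indepFun_process
    (X := fun (i : Set.Iio (0 : ℤ)) (ξ : ℤ → V) => ξ i)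
    (Y := fun (i : Set.Ici (k : ℤ)) (ξ : ℤ → V) => ξ i)
    (fun _ => measurable_pi_apply _) (fun _ => measurable_pi_apply _) fun I J => ?_
  obtain ⟨m, hm⟩ : ∃ m : ℕ, ∀ i ∈ I, i.1.natAbs < m :=
    ⟨I.sup (fun i => i.1.natAbs) + 1,
      fun i hi => Nat.lt_succ_of_le (Finset.le_sup (f := fun i => i.1.natAbs) hi)⟩
  obtain ⟨n, hn⟩ : ∃ n : ℕ, ∀ i ∈ J, i.1.natAbs < n :=
    ⟨J.sup (fun i => i.1.natAbs) + 1,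
      fun i hi => Nat.lt_succ_of_le (Finset.le_sup (f := fun i => i.1.natAbs) hi)⟩
  let g : (Fin m → V) → I → V := fun x i =>
    x ⟨(i.1.1 + m).toNat, by have := hm i i.2; have : i.1.1 < 0 := i.1.2; omega⟩
  let g' : (Fin n → V) → J → V := fun x i =>
    x ⟨(i.1.1 - k₀).toNat, by have := hn i i.2; have : (k : ℤ) ≤ i.1.1 := i.1.2; omega⟩
  have e1 : (fun (ξ : ℤ → V) (i : I) => ξ i.1.1) = g ∘ window (-m) m := by
    funext ξ i
    have := hm i i.2
    simp only [Function.comp, g, window]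
    congr 1
    omega
  have e2 : (fun (ξ : ℤ → V) (i : J) => ξ i.1.1) = g' ∘ window k₀ n := by
    funext ξ i
    have h1 := hn i i.2
    have h2 := i.1.2
    simp only [Set.mem_Ici] at h2
    simp only [Function.comp, g', window]
    congr 1
    omega
  rw [e1, e2]
  exact (hw m n).comp (measurable_of_countable g) (measurable_of_countable g')

end IsInsertionLaw

end WeightedGraph

theorem theorem2 {V : Type*} [Fintype V] [MeasurableSpace V] [DiscreteMeasurableSpace V]
    (G : WeightedGraph V) (w : ℝ) (hG : G.HasUniformWeight w) (k : ℕ) :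
    (G.IsConsistent ∧ ∃ μ : Measure (ℤ → V), G.IsInsertionLaw μ ∧ IsStationaryKDependent k μ) ↔
      w = 1 ∧
        ((∃ r : ℕ, 1 ≤ r ∧ G.IsIsomorphic (WeightedGraph.completeMultipartite 3 r)) ∧ 2 ≤ k ∨
         (∃ r : ℕ, 1 ≤ r ∧ G.IsIsomorphic (WeightedGraph.completeMultipartite 4 r)) ∧ 1 ≤ k) := by
  constructor
  · rintro ⟨hcons, μ, hμ, hk⟩
    obtain ⟨K, hK, hgap⟩ := hμ.exists_gapSum_eq hcons hk
    obtain ⟨rfl, s, hs, a, c, hac⟩ := hcons.exists_isEquipartite hG hK hgap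
    refine ⟨rfl, ?_⟩
    obtain ⟨j, hj1, hjk, hj⟩ := hs.exists_mul_eq hac ((hgap a a).trans (hgap a c).symm)
    have := hcons.nonempty
    obtain ⟨q, hs1, hcard, hiso⟩ := hs.exists_isIsomorphic
    -- Substitute `|V| = q s` and cancel `s`. Then `j` divides 2, which leaves `(j, q) = (1, 4)` and
    -- `(2, 3)`.
    have hq : (j : ℤ) * (q - 2) = 2 := by
      have hs0 : (s : ℝ) ≠ 0 := by positivity
      have : ((j : ℝ) * (q - 2)) * s = 2 * s := by
        rw [← hj, hcard]
        push_cast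
        ring
      exact_mod_cast mul_right_cancel₀ hs0 this
    have hj2 : j ≤ 2 := by
      have := Int.le_of_dvd (by norm_num) (Dvd.intro _ hq)
      omega
    interval_cases j
    · obtain rfl : q = 4 := by omega
      exact Or.inr ⟨⟨s, hs1, hiso⟩, hjk⟩
    · obtain rfl : q = 3 := by omega
      exact Or.inl ⟨⟨s, hs1, hiso⟩, hjk⟩
  -- The decoupling gap has length `k₀ + 1`.
  · have key : ∀ (q r k₀ : ℕ), 2 ≤ q → 1 ≤ r → ((k₀ : ℝ) + 1) * (q - 2) = 2 → k₀ + 1 ≤ k →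
        G.IsIsomorphic (WeightedGraph.completeMultipartite q r) →
        G.IsConsistent ∧ ∃ μ : Measure (ℤ → V), G.IsInsertionLaw μ ∧
          IsStationaryKDependent k μ := by
      intro q r k₀ hq hr hqk hk hiso
      obtain ⟨hs, hcard⟩ := WeightedGraph.isEquipartite_of_isIsomorphic hiso
      have hne : Nonempty V := Fintype.card_pos_iff.1 (by rw [hcard]; positivity)
      have hle : 2 * r ≤ Fintype.card V := by rw [hcard]; gcongr
      have hcons := hs.isConsistent hle
      obtain ⟨μ, hμ⟩ := hcons.exists_isInsertionLaw
      refine ⟨hcons, μ, hμ, hμ.isStationaryKDependent hk fun m n x y =>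
        hs.sum_insertionProb_eq_mul hle ?_ x y⟩
      rw [hcard]
      push_cast
      linear_combination (r : ℝ) * hqk
    rintro ⟨rfl, ⟨⟨r, hr, hiso⟩, hk⟩ | ⟨⟨r, hr, hiso⟩, hk⟩⟩
    · exact key 3 r 1 (by norm_num) hr (by norm_num) hk hiso
    · exact key 4 r 0 (by norm_num) hr (by norm_num) hk hiso
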